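/- **Setting.** Let $\mathcal F$ be a class of measurable functions $\mathcal A\to\mathbb R$ and $T$ the horizon. In rounds $t=1,\dots,T$ an arbitrary decision set $\mathcal D_t\subseteq\mathcal A$ is revealed, the learner chooses $a_t\in\mathcal D_t$ and then observes $r_t=f^*(a_t)+\epsilon_t$ and $\sigma_t$, where $f^*\in\mathcal F$ is unknown, $|f^*(a)|\le C$ for all $a\in\mathcal A$, $0\le\sigma_t<R$, and $\epsilon_t$ is conditionally $\sigma_t$-sub-Gaussian given the past $\mathcal G_t$ (which contains $a_1,\dots,a_t$, $\epsilon_1,\dots,\epsilon_{t-1}$, $\sigma_1,\dots,\sigma_t$): $\mathbb E[e^{u\epsilon_t}\mid\mathcal G_t]\le e^{u^2\sigma_t^2/2}$ for all $u\in\mathbb R$. Let $a_t^*\in\arg\max_{a\in\mathcal D_t}f^*(a)$ (assumed to exist), $\mathrm{Regret}(T)=\sum_{t=1}^T(f^*(a_t^*)-f^*(a_t))$, $\sigma_{\max}=\max_{t\le T}\sigma_t$, and let $\Delta$ be the infimum of $f^*(a_t^*)-f^*(a)$ over all $t\le T$ and all sub-optimal $a\in\mathcal D_t$ ($\Delta=\infty$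 if there are none). **Complexity.** $\mathcal N(\mathcal F,\alpha,\|\cdot\|_\infty)$ is the $\alpha$-covering number of $\mathcal F$ in sup-norm (centers in $\mathcal F$). $\dim_E=\dim_E(\mathcal F,T^{-2})$ is the eluder dimension: the maximal length of a sequence in $\mathcal A$ for which there is $\epsilon'\ge T^{-2}$ such that for each element $a$, with predecessors $a_1,\dots,a_n$, there are $f,g\in\mathcal F$ with $\sqrt{\sum_{i\le n}(f(a_i)-g(a_i))^2}\le\epsilon'$ and $f(a)-g(a)>\epsilon'$. Both numbers are assumed finite. **Algorithm.** Fix $\bar\sigma>0$, $\delta\in(0,1)$, $\alpha=T^{-2}$; put $N_\alpha=\mathcal N(\mathcal F,\alpha,\|\cdot\|_\infty)$, $L=\lceil\log_2(R/\bar\sigma)\rceil$, and, for $0\le l<L$, $$\beta_{t,l}^2=8(2^{l+1}\bar\sigma)^2\log\frac{2N_\alpha L}{\delta}+4t\alpha\Big(C+\sqrt{(2^{l+1}\bar\sigma)^2\log\frac{4t(t+1)L}{\delta}}\Big).$$ After round $t$ its data are assigned to a level $l_t\in\{0,\dots,L-1\}$ with $2^{l_t}\bar\sigma\le\max(\bar\sigma,\sigma_t)\le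 2^{l_t+1}\bar\sigma$ (the choice of $l_t$ does not depend on $\epsilon_t$). With $\Psi_{t,l}=\{s<t:l_s=l\}$, let $\hat f_{t,l}$ minimize $\sum_{s\in\Psi_{t,l}}(f(a_s)-r_s)^2$ over $f\in\mathcal F$ and let $\mathcal C_{t,l}=\{f\in\mathcal F:\sum_{s\in\Psi_{t,l}}(f(a_s)-\hat f_{t,l}(a_s))^2\le\beta_{t,l}^2\}$. The learner plays $a_t\in\arg\max_{a\in\mathcal D_t}\min_{0\le l<L}\sup_{f\in\mathcal C_{t,l}}f(a)$. Minimizers and maximizers are assumed to exist. **Claim.** There are absolute constants $K>0$ and $p\in\mathbb N$ such that for every $\mathcal F$, every $C$ and every $s>0$ there is a $T_0=T_0(\mathcal F,C,s)$ such that for all $T\ge T_0$, all $R,\bar\sigma,\delta$ and every instance as above with $\sigma_{\max}>\bar\sigma$ and $\sigma_{\max}\ge s$, with probability at least $1-\delta$, $$\mathrm{Regret}(T)\le K\Big(\log\frac{TR}{\bar\sigma\delta}\Big)^{p}\cdot\frac{\sigma_{\max}^2\,\dim_E\,\log\mathcal N(\mathcal F,T^{-2},\|\cdot\|_\infty)}{\Delta},$$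 that is, $\mathrm{Regret}(T)=\tilde O\big(\sigma_{\max}^2\dim_E\log\mathcal N(\mathcal F,T^{-2},\|\cdot\|_\infty)/\Delta\big)$. -/

import Mathlib

open MeasureTheory
open scoped ENNReal NNReal

noncomputable section

namespace HetBandit

/-! ### Complexity measures of a function class -/

/-- The action `a` is `ε`-dependent on the actions `b i`, `i ∈ I`, with respect to `F`. -/
def EpsDependent {A ι : Type*} (F : Set (A → ℝ)) (ε : ℝ) (b : ι → A) (I : Finset ι) (a : A) :
    Prop :=
  ∀ f ∈ F, ∀ g ∈ F, √(∑ i ∈ I, (f (b i) - g (b i)) ^ 2) ≤ ε → f a - g a ≤ ε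

/-- The `ε`-eluder dimension: the supremum of the lengths `n` of the sequences in `A` such that,
for some `ε' ≥ ε`, every element is `ε'`-independent of its predecessors. -/
def eluderDim {A : Type*} (F : Set (A → ℝ)) (ε : ℝ) : ℕ∞ :=
  ⨆ (n : ℕ) (b : Fin n → A)
    (_ : ∃ ε' ≥ ε, ∀ k : Fin n, ¬ EpsDependent F ε' b (Finset.Iio k) (b k)), (n : ℕ∞)

/-- The `α`-covering number of `F` in the sup-norm: the least number of members of `F` such that
every member of `F` is uniformly within `α` of one of them. -/
def coverNum {A : Type*} (F : Set (A → ℝ)) (α : ℝ≥0) : ℕ∞ :=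
  Metric.coveringNumber α (UniformFun.ofFun '' F)

/-! ### The bandit model -/

/-- The quantities that occur in a bandit interaction on the probability space `Ω`, indexed by the
round `t` (the rounds are `1, …, T`). -/
structure Interaction (A Ω : Type*) where
  /-- the decision set `D_t` -/
  decision : ℕ → Ω → Set A
  /-- the chosen action `a_t` -/
  act : ℕ → Ω → A
  /-- an optimal action `a_t^*` of round `t` -/
  best : ℕ → Ω → A
  /-- the noise `ε_t` -/
  noise : ℕ → Ω → ℝ
  /-- the variance proxy `σ_t`, revealed after the choice of `a_t` -/
  sd : ℕ → Ω → ℝ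

namespace Interaction

variable {A Ω : Type*} (X : Interaction A Ω) (fstar : A → ℝ)

/-- The reward `r_t = f^*(a_t) + ε_t`. -/
def reward (t : ℕ) (ω : Ω) : ℝ := fstar (X.act t ω) + X.noise t ω

/-- The cumulative regret of the rounds `1, …, T`. -/
def regret (T : ℕ) (ω : Ω) : ℝ :=
  ∑ t ∈ Finset.Icc 1 T, (fstar (X.best t ω) - fstar (X.act t ω))

/-- The gap `Δ_t` of round `t`: the infimum of `f^*(a_t^*) - f^*(a)` over the sub-optimal actions
`a ∈ D_t` (it is `∞` if every action of `D_t` is optimal). -/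
def gapAt (t : ℕ) (ω : Ω) : ℝ≥0∞ :=
  ⨅ a ∈ {a ∈ X.decision t ω | fstar a < fstar (X.best t ω)},
    ENNReal.ofReal (fstar (X.best t ω) - fstar a)

/-- The smallest gap `Δ` of the rounds `1, …, T`. -/
def gap (T : ℕ) (ω : Ω) : ℝ≥0∞ := ⨅ t ∈ Finset.Icc 1 T, X.gapAt fstar t ω

/-- `σ_max = max_{1 ≤ t ≤ T} σ_t`. -/
def sdMax (T : ℕ) (ω : Ω) : ℝ := sSup ((fun t => X.sd t ω) '' Set.Icc 1 T)

/-- The bandit model over `T` rounds with reward function `fstar` and conditionally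
`σ_t`-sub-Gaussian noise, where `0 ≤ σ_t < R`. The `σ`-algebra `𝓖 t` is what is known just before
`ε_t` is drawn: it contains `a_1, …, a_t`, `ε_1, …, ε_{t-1}` and `σ_1, …, σ_t`. The decision sets
are arbitrary. -/
structure IsBandit [MeasurableSpace A] {mΩ : MeasurableSpace Ω} (P : Measure Ω)
    (𝓖 : Filtration ℕ mΩ) (T : ℕ) (R : ℝ) : Prop where
  act_mem : ∀ t ∈ Finset.Icc 1 T, ∀ ω, X.act t ω ∈ X.decision t ω
  best_mem : ∀ t ∈ Finset.Icc 1 T, ∀ ω, X.best t ω ∈ X.decision t ω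
  best_max : ∀ t ∈ Finset.Icc 1 T, ∀ ω, ∀ a ∈ X.decision t ω, fstar a ≤ fstar (X.best t ω)
  measurable_act : ∀ t ∈ Finset.Icc 1 T, Measurable[𝓖 t] (X.act t)
  measurable_sd : ∀ t ∈ Finset.Icc 1 T, Measurable[𝓖 t] (X.sd t)
  measurable_noise : ∀ t ∈ Finset.Icc 1 T, Measurable[𝓖 (t + 1)] (X.noise t)
  sd_nonneg : ∀ t ∈ Finset.Icc 1 T, ∀ ω, 0 ≤ X.sd t ω
  sd_lt : ∀ t ∈ Finset.Icc 1 T, ∀ ω, X.sd t ω < R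
  integrable_exp : ∀ t ∈ Finset.Icc 1 T, ∀ u : ℝ,
    Integrable (fun ω => Real.exp (u * X.noise t ω)) P
  subGaussian : ∀ t ∈ Finset.Icc 1 T, ∀ u : ℝ,
    P[fun ω => Real.exp (u * X.noise t ω) | 𝓖 t] ≤ᵐ[P]
      fun ω => Real.exp (u ^ 2 * X.sd t ω ^ 2 / 2)

end Interaction

/-! ### Multi-level learning with empirical risk minimization -/

/-- The number of levels `L = ⌈log₂ (R / σbar)⌉`; the levels are `0, …, L - 1`. -/
def numLevels (R σbar : ℝ) : ℕ := ⌈Real.logb 2 (R / σbar)⌉₊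

/-- The confidence radius `β_{t,l}`, with `N` the covering number of the class at scale `α`. -/
def radius (C σbar α δ : ℝ) (N L t l : ℕ) : ℝ :=
  √(8 * (2 ^ (l + 1) * σbar) ^ 2 * Real.log (2 * N * L / δ)
    + 4 * t * α * (C + √((2 ^ (l + 1) * σbar) ^ 2 * Real.log (4 * t * (t + 1) * L / δ))))

/-- The choices made by the learner, besides the actions. -/
structure Learner (A Ω : Type*) where
  /-- the level `l_t` to which the data point of round `t` is assigned -/
  level : ℕ → Ω → ℕ
  /-- the estimate `\hat f_{t,l}` of level `l` that is available at the start of round `t` -/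
  est : ℕ → ℕ → Ω → A → ℝ

namespace Learner

variable {A Ω : Type*} (Y : Learner A Ω) (X : Interaction A Ω)

/-- The index set `Ψ_{t,l}`: the rounds before `t` whose data were assigned to level `l`. -/
def indexSet (t l : ℕ) (ω : Ω) : Finset ℕ := {s ∈ Finset.Ico 1 t | Y.level s ω = l}

/-- The empirical squared loss of `f` on the data of `Ψ_{t,l}`. -/
def loss (fstar : A → ℝ) (t l : ℕ) (ω : Ω) (f : A → ℝ) : ℝ :=
  ∑ s ∈ Y.indexSet t l ω, (f (X.act s ω) - X.reward fstar s ω) ^ 2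

/-- The confidence set `C_{t,l}` of radius `β` around the estimate. (In round `1` the index set is
empty and the confidence set is all of `F`.) -/
def confSet (F : Set (A → ℝ)) (β : ℝ) (t l : ℕ) (ω : Ω) : Set (A → ℝ) :=
  {f ∈ F | ∑ s ∈ Y.indexSet t l ω, (f (X.act s ω) - Y.est t l ω (X.act s ω)) ^ 2 ≤ β ^ 2}

/-- The optimistic index `min_{l} max_{f ∈ C_{t,l}} f(a)` of the action `a` in round `t`. -/
def index (F : Set (A → ℝ)) (β : ℕ → ℕ → ℝ) (L t : ℕ) (ω : Ω) (a : A) : ℝ :=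
  ⨅ l : Fin L, ⨆ f : Y.confSet X F (β t l) t l ω, (f : A → ℝ) a

/-- The interaction `X` is produced by multi-level learning with the class `F`, the `L` levels
attached to `σbar`, and the radii `β t l`, with empirical risk minimization as its subroutine:
the rule by which the data point of round `t` is assigned to a level does not look at the
noise `ε_t`, the estimates are least-squares estimates, and the actions are optimistic. -/
structure IsML2 {mΩ : MeasurableSpace Ω} (𝓖 : Filtration ℕ mΩ) (F : Set (A → ℝ))
    (fstar : A → ℝ) (T L : ℕ) (σbar : ℝ) (β : ℕ → ℕ → ℝ) : Prop where
  measurable_level : ∀ t ∈ Finset.Icc 1 T, Measurable[𝓖 t] (Y.level t)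
  level_lt : ∀ t ∈ Finset.Icc 1 T, ∀ ω, Y.level t ω < L
  le_level : ∀ t ∈ Finset.Icc 1 T, ∀ ω, max σbar (X.sd t ω) ≤ 2 ^ (Y.level t ω + 1) * σbar
  level_le : ∀ t ∈ Finset.Icc 1 T, ∀ ω, 2 ^ Y.level t ω * σbar ≤ max σbar (X.sd t ω)
  est_mem : ∀ t ∈ Finset.Icc 1 T, ∀ l < L, ∀ ω, Y.est t l ω ∈ F
  est_min : ∀ t ∈ Finset.Icc 1 T, ∀ l < L, ∀ ω, ∀ f ∈ F,
    Y.loss X fstar t l ω (Y.est t l ω) ≤ Y.loss X fstar t l ω f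
  act_max : ∀ t ∈ Finset.Icc 1 T, ∀ ω, ∀ a ∈ X.decision t ω,
    Y.index X F β L t ω a ≤ Y.index X F β L t ω (X.act t ω)

end Learner

end HetBandit

end

/-!
Regret of multi-level optimistic least squares in terms of the smallest gap.

*Confidence.* Fix a level `l` with noise scale `S`, the data `Ψ` of that level at time `t`, and let
`v` be the deviation of the least-squares estimate from the true function on `Ψ`, `g` a member of
the cover that is `α`-close to the estimate, and `e` the noise. For each `g` the process
`exp (∑ (4 (g - f*) e - (g - f*)²) / (8 S²))` is a nonnegative supermartingale, so Ville's
inequality bounds its exponent uniformly in time (`measure_excess_loss_le`). The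
discretization error is at most `4 α √(|Ψ| Q) + α² |Ψ|` with `Q = ∑ e²`, and also `∑ v² ≤ 4 Q`.
Since the class need not be bounded, these two bounds are played against each other (`sum_sq_le_of_leastSquares`): together with
a tail bound for `Q` (`measure_sum_sq_noise_le`) they show that the true function lies in all the
confidence sets, for exactly the given radii (`measure_exists_notMem_confSet_le`).

*Counting.* By optimism the regret of a round is at most the width of the confidence set of any
level at the chosen action. If it exceeds `x`, some function in the confidence set of the round's
own level has squared deviations at most `4 β²` on the data of that level and deviates by more than
`x` now; the eluder dimension `d` allows at most `(4 β² / x² + 1) d` such rounds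
(`card_le_mul_eluderDim`, `card_lt_regret_le`).

*Summation.* The regret of a round is `0` or at least the gap `Δ`, so summing over the dyadic scales
between `Δ` and `2 C` costs `O(β² / Δ + C) d` per scale and level (`regret_mul_le`), and a level in
use has `S ≤ 2 σ_max`, which makes `β²` of order `σ_max² log N` up to logarithms (`radius_sq_le`).
The terms with `C` are absorbed by one more logarithm for large `T`, and a gap below `2 T⁻²` makes
the claim trivial (`regret_mul_gap_le`). A class with at least two members has `N ≥ 2` and `d ≥ 1`
for large `T`; with a single member optimistic actions have no regret.
-/

namespace HetBandit

/-! ### Conditionally sub-Gaussian noise -/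

section SubGaussian

variable {Ω : Type*} {m mΩ : MeasurableSpace Ω} {P : Measure Ω} {e σ : Ω → ℝ}

/-- A conditional expectation bound, tested against a nonnegative random variable that is
measurable with respect to the conditioning `σ`-algebra. -/
lemma lintegral_mul_ofReal_le_of_condExp_le [IsFiniteMeasure P] (hm : m ≤ mΩ) {f g : Ω → ℝ}
    (hf : Measurable f) (hf0 : 0 ≤ f) (hfi : Integrable f P) (hg : Measurable g)
    (hfg : P[f | m] ≤ᵐ[P] g) {W : Ω → ℝ≥0∞} (hW : Measurable[m] W) :
    ∫⁻ ω, W ω * ENNReal.ofReal (f ω) ∂P ≤ ∫⁻ ω, W ω * ENNReal.ofReal (g ω) ∂P := by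
  have key : (P.withDensity fun ω => ENNReal.ofReal (f ω)).trim hm
      ≤ (P.withDensity fun ω => ENNReal.ofReal (g ω)).trim hm := by
    refine Measure.le_iff.2 fun s hs => ?_
    rw [trim_measurableSet_eq hm hs, trim_measurableSet_eq hm hs,
      withDensity_apply _ (hm s hs), withDensity_apply _ (hm s hs),
      ← ofReal_integral_eq_lintegral_ofReal hfi.restrict (ae_of_all _ hf0),
      ← setIntegral_condExp hm hfi hs, ofReal_integral_eq_lintegral_ofReal
        integrable_condExp.restrict (ae_restrict_of_ae (condExp_nonneg (ae_of_all _ hf0)))]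
    exact lintegral_mono_ae (ae_restrict_of_ae
      (hfg.mono fun ω h => ENNReal.ofReal_le_ofReal h))
  have h := lintegral_mono' key (le_refl W)
  rw [lintegral_trim hm hW, lintegral_trim hm hW,
    lintegral_withDensity_eq_lintegral_mul _ hf.ennreal_ofReal (hW.mono hm le_rfl),
    lintegral_withDensity_eq_lintegral_mul _ hg.ennreal_ofReal (hW.mono hm le_rfl)] at h
  simpa only [Pi.mul_apply, mul_comm] using h

variable (m P e σ) in
/-- `e` is conditionally `σ`-sub-Gaussian given `m`, in the form of an inequality between
expectations: `E[W exp (u e - u² σ² / 2)] ≤ E[W]` for every nonnegative `m`-measurable weight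
`W`, where the moment parameter `u` is itself any `m`-measurable random variable. -/
def WeightedSubGaussian : Prop :=
  ∀ (u : Ω → ℝ) (W : Ω → ℝ≥0∞), Measurable[m] u → Measurable[m] W →
    ∫⁻ ω, W ω * ENNReal.ofReal (Real.exp (u ω * e ω - u ω ^ 2 * σ ω ^ 2 / 2)) ∂P ≤ ∫⁻ ω, W ω ∂P

/-- The exceptional null set in the definition of conditional sub-Gaussianity depends on the
moment parameter. A random parameter with finitely many values is handled by splitting, and a
general one by approximation and Fatou's lemma. -/
lemma weightedSubGaussian_of_condExp_le [IsFiniteMeasure P] (hm : m ≤ mΩ) (he : Measurable e)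
    (hσ : Measurable[m] σ) (hint : ∀ u : ℝ, Integrable (fun ω => Real.exp (u * e ω)) P)
    (h : ∀ u : ℝ, P[fun ω => Real.exp (u * e ω) | m] ≤ᵐ[P]
      fun ω => Real.exp (u ^ 2 * σ ω ^ 2 / 2)) : WeightedSubGaussian m P e σ := by
  have hσ' : Measurable σ := hσ.mono hm le_rfl
  have fixed : ∀ (c : ℝ) (W : Ω → ℝ≥0∞), Measurable[m] W →
      ∫⁻ ω, W ω * ENNReal.ofReal (Real.exp (c * e ω - c ^ 2 * σ ω ^ 2 / 2)) ∂P
        ≤ ∫⁻ ω, W ω ∂P := by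
    intro c W hW
    have hE : Measurable[m] fun ω => Real.exp (-(c ^ 2 * σ ω ^ 2 / 2)) := by fun_prop
    have h1 := lintegral_mul_ofReal_le_of_condExp_le hm (by fun_prop)
      (fun ω => (Real.exp_pos _).le) (hint c) (by fun_prop) (h c)
      (W := fun ω => W ω * ENNReal.ofReal (Real.exp (-(c ^ 2 * σ ω ^ 2 / 2))))
      (hW.mul hE.ennreal_ofReal)
    simp only [mul_assoc, ← ENNReal.ofReal_mul (Real.exp_pos _).le, ← Real.exp_add] at h1
    simpa [sub_eq_add_neg, add_comm] using h1
  have simple : ∀ (a : SimpleFunc ℝ ℝ) (u : Ω → ℝ) (W : Ω → ℝ≥0∞), Measurable[m] u →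
      Measurable[m] W →
      ∫⁻ ω, W ω * ENNReal.ofReal (Real.exp (a (u ω) * e ω - a (u ω) ^ 2 * σ ω ^ 2 / 2)) ∂P
        ≤ ∫⁻ ω, W ω ∂P := by
    intro a u' W hu₁ hW
    obtain ⟨u, hua⟩ : ∃ u : Ω → ℝ, ∀ ω, a (u' ω) = u ω := ⟨_, fun _ => rfl⟩
    have hu : Measurable[m] u := by
      rw [← funext hua]
      exact a.measurable.comp hu₁
    simp only [hua]
    have hu' : Measurable u := hu.mono hm le_rfl
    have hset : ∀ c : ℝ, MeasurableSet[m] (u ⁻¹' {c}) := fun c => hu (measurableSet_singleton c)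
    have split : ∀ V : Ω → ℝ≥0∞, Measurable V →
        ∫⁻ ω, V ω ∂P = ∑ c ∈ a.range, ∫⁻ ω in u ⁻¹' {c}, V ω ∂P := by
      intro V hV
      rw [← lintegral_biUnion_finset _ (fun c _ => hm _ (hset c))]
      · have : (⋃ c ∈ a.range, u ⁻¹' {c}) = Set.univ := by
          ext ω; simp [← hua]
        rw [this, setLIntegral_univ]
      · intro c _ c' _ hcc
        exact Set.disjoint_left.2 fun ω h1 h2 => hcc (h1.symm.trans h2)
    rw [split _ (by have := hW.mono hm le_rfl; fun_prop), split _ (hW.mono hm le_rfl)]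
    refine Finset.sum_le_sum fun c _ => ?_
    have h2 := fixed c ((u ⁻¹' {c}).indicator W) (hW.indicator (hset c))
    rw [lintegral_indicator (hm _ (hset c))] at h2
    refine le_trans (le_of_eq ?_) h2
    rw [← lintegral_indicator (hm _ (hset c))]
    refine lintegral_congr fun ω => ?_
    by_cases hω : u ω = c
    · simp [hω]
    · simp [hω]
  intro u W hu hW
  let a : ℕ → SimpleFunc ℝ ℝ := SimpleFunc.approxOn id measurable_id Set.univ 0 trivial
  let v : ℕ → Ω → ℝ := fun n ω => a n (u ω)
  have hv : ∀ ω, Filter.Tendsto (fun n => v n ω) Filter.atTop (nhds (u ω)) := fun ω =>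
    SimpleFunc.tendsto_approxOn measurable_id (Set.mem_univ 0) (by simp)
  have hlim : ∀ ω, Filter.Tendsto (fun n => W ω * ENNReal.ofReal (Real.exp
      (v n ω * e ω - v n ω ^ 2 * σ ω ^ 2 / 2))) Filter.atTop
      (nhds (W ω * ENNReal.ofReal (Real.exp (u ω * e ω - u ω ^ 2 * σ ω ^ 2 / 2)))) := by
    intro ω
    refine ENNReal.Tendsto.const_mul (ENNReal.tendsto_ofReal
      ((Real.continuous_exp.tendsto _).comp ?_)) (Or.inl ?_)
    · exact ((hv ω).mul_const _).sub ((((hv ω).pow 2).mul_const _).div_const _)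
    · simp [Real.exp_pos]
  calc _ = ∫⁻ ω, Filter.liminf (fun n => W ω * ENNReal.ofReal (Real.exp
      (v n ω * e ω - v n ω ^ 2 * σ ω ^ 2 / 2))) Filter.atTop ∂P :=
        lintegral_congr fun ω => (hlim ω).liminf_eq.symm
    _ ≤ Filter.liminf (fun n => ∫⁻ ω, W ω * ENNReal.ofReal (Real.exp
      (v n ω * e ω - v n ω ^ 2 * σ ω ^ 2 / 2)) ∂P) Filter.atTop := by
        refine lintegral_liminf_le fun n => ?_
        have h1 : Measurable (v n) := (a n).measurable.comp (hu.mono hm le_rfl)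
        have h2 := hW.mono hm le_rfl
        fun_prop
    _ ≤ ∫⁻ ω, W ω ∂P :=
        Filter.liminf_le_of_frequently_le'
          (Filter.Frequently.of_forall fun n => simple (a n) u W hu hW)

/-- A Gaussian integral: `E[exp (Z² S² / 2)] = 2` for a centred Gaussian variable `Z` of variance
`3 / (4 S²)`. -/
lemma lintegral_exp_sq_gaussianReal {S : ℝ} (hS : 0 < S) {v : ℝ≥0}
    (hv : (v : ℝ) = 3 / (4 * S ^ 2)) :
    ∫⁻ z, ENNReal.ofReal (Real.exp (z ^ 2 * S ^ 2 / 2))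
      ∂(ProbabilityTheory.gaussianReal 0 v) = 2 := by
  have hv0 : 0 < (v : ℝ) := by rw [hv]; positivity
  have hv1 : v ≠ 0 := by exact_mod_cast hv0.ne'
  rw [ProbabilityTheory.gaussianReal_of_var_ne_zero _ hv1,
    lintegral_withDensity_eq_lintegral_mul _ (ProbabilityTheory.measurable_gaussianPDF _ _)
      (by fun_prop)]
  have hb : (0 : ℝ) < S ^ 2 / 6 := by positivity
  have hpt : ∀ z : ℝ, (ProbabilityTheory.gaussianPDF 0 v * fun z : ℝ =>
      ENNReal.ofReal (Real.exp (z ^ 2 * S ^ 2 / 2))) z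
      = ENNReal.ofReal ((√(2 * Real.pi * v))⁻¹ * Real.exp (-(S ^ 2 / 6) * z ^ 2)) := by
    intro z
    rw [Pi.mul_apply, ProbabilityTheory.gaussianPDF, ← ENNReal.ofReal_mul
      (ProbabilityTheory.gaussianPDFReal_nonneg _ _ _), ProbabilityTheory.gaussianPDFReal,
      mul_assoc, ← Real.exp_add, hv]
    congr 3
    field_simp
    ring
  simp only [hpt]
  rw [← ofReal_integral_eq_lintegral_ofReal ((integrable_exp_neg_mul_sq hb).const_mul _)
    (ae_of_all _ fun z => by positivity), integral_const_mul, integral_gaussian]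
  have : (√(2 * Real.pi * v))⁻¹ * √(Real.pi / (S ^ 2 / 6)) = 2 := by
    rw [inv_mul_eq_div, ← Real.sqrt_div' _ (by positivity), hv]
    rw [show Real.pi / (S ^ 2 / 6) / (2 * Real.pi * (3 / (4 * S ^ 2))) = 2 ^ 2 by
      have := Real.pi_pos; field_simp; norm_num]
    exact Real.sqrt_sq (by norm_num)
  rw [this]
  norm_num

/-- Exponential moment of the squared noise on an event `G` where `σ ≤ S`. The square is
linearised by writing `exp (3 e² / (8 S²))` as the average of `exp (z e)` over a Gaussian `z`. -/
lemma WeightedSubGaussian.lintegral_mul_exp_sq_le [SFinite P]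
    (h : WeightedSubGaussian m P e σ) (hm : m ≤ mΩ)
    (he : Measurable e) (hσ : Measurable[m] σ) (hσ0 : ∀ ω, 0 ≤ σ ω) {S : ℝ} (hS : 0 < S)
    {G : Set Ω} (hG : MeasurableSet[m] G) (hGS : ∀ ω ∈ G, σ ω ≤ S) {W : Ω → ℝ≥0∞}
    (hW : Measurable[m] W) :
    ∫⁻ ω, W ω * G.indicator (fun ω => ENNReal.ofReal (Real.exp (3 * e ω ^ 2 / (8 * S ^ 2)))) ω ∂P
      ≤ 2 * ∫⁻ ω in G, W ω ∂P := by
  obtain ⟨v, hv⟩ : ∃ v : ℝ≥0, (v : ℝ) = 3 / (4 * S ^ 2) := ⟨⟨3 / (4 * S ^ 2), by positivity⟩, rfl⟩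
  have hσ' : Measurable σ := hσ.mono hm le_rfl
  have hW' : Measurable W := hW.mono hm le_rfl
  have hG' : MeasurableSet G := hm G hG
  let γ := ProbabilityTheory.gaussianReal 0 v
  have hmix : ∀ x : ℝ, ENNReal.ofReal (Real.exp (3 * x ^ 2 / (8 * S ^ 2)))
      = ∫⁻ z, ENNReal.ofReal (Real.exp (z * x)) ∂γ := by
    intro x
    have h1 := ProbabilityTheory.mgf_id_gaussianReal (μ := 0) (v := v)
    have h2 := congrFun h1 x
    rw [ProbabilityTheory.mgf] at h2
    rw [← ofReal_integral_eq_lintegral_ofReal]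
    · congr 1
      rw [show (fun z : ℝ => Real.exp (z * x)) = fun z => Real.exp (x * id z) by
        funext z; simp [mul_comm], h2, hv]
      congr 1
      field_simp
      ring
    · simpa [mul_comm] using ProbabilityTheory.integrable_exp_mul_gaussianReal (μ := 0) (v := v) x
    · exact ae_of_all _ fun z => (Real.exp_pos _).le
  calc _ = ∫⁻ ω, ∫⁻ z, G.indicator W ω * ENNReal.ofReal (Real.exp (z * e ω)) ∂γ ∂P := by
        refine lintegral_congr fun ω => ?_
        rw [lintegral_const_mul _ (by fun_prop), ← hmix]
        by_cases hω : ω ∈ G <;> simp [hω]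
    _ = ∫⁻ z, ∫⁻ ω, G.indicator W ω * ENNReal.ofReal (Real.exp (z * e ω)) ∂P ∂γ := by
        refine lintegral_lintegral_swap (Measurable.aemeasurable ?_)
        have : Measurable (G.indicator W) := hW'.indicator hG'
        exact (this.comp measurable_fst).mul (by fun_prop)
    _ ≤ ∫⁻ z, ∫⁻ ω, G.indicator W ω * ENNReal.ofReal (Real.exp (z ^ 2 * S ^ 2 / 2)) ∂P ∂γ := by
        refine lintegral_mono fun z => ?_
        have h1 := h (fun _ => z)
          (fun ω => G.indicator W ω * ENNReal.ofReal (Real.exp (z ^ 2 * S ^ 2 / 2)))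
          measurable_const ((hW.indicator hG).mul measurable_const)
        refine le_trans (lintegral_mono fun ω => ?_) h1
        by_cases hω : ω ∈ G
        · simp only [hω, Set.indicator_of_mem, mul_assoc]
          rw [← ENNReal.ofReal_mul (Real.exp_pos _).le, ← Real.exp_add]
          gcongr
          have : σ ω ^ 2 ≤ S ^ 2 := pow_le_pow_left₀ (hσ0 ω) (hGS ω hω) 2
          nlinarith [mul_le_mul_of_nonneg_left this (sq_nonneg z)]
        · simp [hω]
    _ = 2 * ∫⁻ ω in G, W ω ∂P := by
        simp_rw [lintegral_mul_const _ (hW'.indicator hG')]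
        rw [lintegral_const_mul _ (by fun_prop), lintegral_exp_sq_gaussianReal hS hv,
          lintegral_indicator hG', mul_comm]

end SubGaussian

/-! ### Products of conditionally bounded factors -/

section Products

variable {Ω : Type*} {mΩ : MeasurableSpace Ω} {P : Measure Ω} {𝓖 : Filtration ℕ mΩ}
  {Y : ℕ → Ω → ℝ≥0∞} {T : ℕ} {c : ℝ≥0∞}

lemma measurable_prod_Ico (hY : ∀ s ∈ Finset.Icc 1 T, Measurable[𝓖 (s + 1)] (Y s)) {t : ℕ}
    (ht : t ≤ T + 1) : Measurable[𝓖 t] fun ω => ∏ s ∈ Finset.Ico 1 t, Y s ω := by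
  refine Finset.measurable_fun_prod _ fun s hs => ?_
  rw [Finset.mem_Ico] at hs
  exact (hY s (Finset.mem_Icc.2 ⟨hs.1, by omega⟩)).mono (𝓖.mono (by omega)) le_rfl

lemma lintegral_prod_Ico_le [IsProbabilityMeasure P]
    (hY : ∀ s ∈ Finset.Icc 1 T, Measurable[𝓖 (s + 1)] (Y s))
    (hc : ∀ s ∈ Finset.Icc 1 T, ∀ W : Ω → ℝ≥0∞, Measurable[𝓖 s] W →
      ∫⁻ ω, W ω * Y s ω ∂P ≤ c * ∫⁻ ω, W ω ∂P) {t : ℕ} (ht : t ≤ T) :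
    ∫⁻ ω, ∏ s ∈ Finset.Ico 1 (t + 1), Y s ω ∂P ≤ c ^ t := by
  induction t with
  | zero => simp
  | succ t ih =>
    have h1 := hc (t + 1) (Finset.mem_Icc.2 ⟨by omega, ht⟩) _
      (measurable_prod_Ico hY (t := t + 1) (by omega))
    simp_rw [Finset.prod_Ico_succ_top (show 1 ≤ t + 1 by omega)]
    calc _ ≤ _ := h1
      _ ≤ c * c ^ t := by gcongr; exact ih (by omega)
      _ = c ^ (t + 1) := (pow_succ' c t).symm

/-- Ville's maximal inequality for a product of factors of conditional mean at most `1`: the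
factors are replaced by `1` from the first time on at which the product reaches the level `x`. -/
lemma mul_measure_exists_le_prod_Ico_le_one [IsProbabilityMeasure P]
    (hY : ∀ s ∈ Finset.Icc 1 T, Measurable[𝓖 (s + 1)] (Y s))
    (hc : ∀ s ∈ Finset.Icc 1 T, ∀ W : Ω → ℝ≥0∞, Measurable[𝓖 s] W →
      ∫⁻ ω, W ω * Y s ω ∂P ≤ ∫⁻ ω, W ω ∂P) (x : ℝ≥0∞) :
    x * P {ω | ∃ t ∈ Finset.Icc 1 (T + 1), x ≤ ∏ s ∈ Finset.Ico 1 t, Y s ω} ≤ 1 := by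
  classical
  -- `A s` is the event that the level `x` has not been reached up to time `s`
  let A : ℕ → Set Ω := fun s => {ω | ∀ t ∈ Finset.Icc 1 s, ∏ r ∈ Finset.Ico 1 t, Y r ω < x}
  have hA : ∀ s ≤ T + 1, MeasurableSet[𝓖 s] (A s) := by
    intro s hs
    have : A s = ⋂ t ∈ Finset.Icc 1 s, {ω | ∏ r ∈ Finset.Ico 1 t, Y r ω < x} := by
      ext ω; simp [A]
    rw [this]
    refine Finset.measurableSet_biInter _ fun t ht => ?_
    rw [Finset.mem_Icc] at ht
    exact ((measurable_prod_Ico hY (by omega)).mono (𝓖.mono ht.2) le_rfl) measurableSet_Iio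
  let Z : ℕ → Ω → ℝ≥0∞ := fun s ω => if ω ∈ A s then Y s ω else 1
  have hZ : ∀ s ∈ Finset.Icc 1 T, Measurable[𝓖 (s + 1)] (Z s) := by
    intro s hs
    have hs' := Finset.mem_Icc.1 hs
    exact Measurable.ite (𝓖.mono (Nat.le_succ s) _ (hA s (by omega))) (hY s hs)
      measurable_const
  have hZc : ∀ s ∈ Finset.Icc 1 T, ∀ W : Ω → ℝ≥0∞, Measurable[𝓖 s] W →
      ∫⁻ ω, W ω * Z s ω ∂P ≤ 1 * ∫⁻ ω, W ω ∂P := by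
    intro s hs W hW
    have hs' := Finset.mem_Icc.1 hs
    have hAs := hA s (by omega)
    have hAs' := 𝓖.le s _ hAs
    have hYs := (hY s hs).mono (𝓖.le _) le_rfl
    have hW' := hW.mono (𝓖.le _) le_rfl
    rw [one_mul, ← lintegral_add_compl (fun ω => W ω * Z s ω) hAs',
      ← lintegral_add_compl W hAs']
    refine add_le_add ?_ (le_of_eq ?_)
    · have h1 := hc s hs ((A s).indicator W) (hW.indicator hAs)
      rw [lintegral_indicator hAs'] at h1
      refine le_trans (le_of_eq ?_) h1
      rw [← lintegral_indicator hAs']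
      refine lintegral_congr fun ω => ?_
      by_cases hω : ω ∈ A s <;> simp [hω, Z]
    · refine setLIntegral_congr_fun hAs'.compl fun ω hω => ?_
      have : ω ∉ A s := hω
      simp [Z, this]
  have hint := lintegral_prod_Ico_le (P := P) hZ hZc (le_refl T)
  rw [one_pow] at hint
  refine le_trans ?_ hint
  refine le_trans ?_ (mul_meas_ge_le_lintegral
    ((measurable_prod_Ico hZ le_rfl).mono (𝓖.le _) le_rfl) x)
  refine mul_le_mul_right (measure_mono fun ω hω => ?_) x
  simp only [Set.mem_ofPred_eq] at hω ⊢
  -- `t` is the first time at which the product reaches `x`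
  obtain ⟨ht, hmin⟩ := And.intro (Nat.find_spec hω) (fun k => Nat.find_min (m := k) hω)
  set t := Nat.find hω
  obtain ⟨ht1, hx⟩ := ht
  rw [Finset.mem_Icc] at ht1
  have hlt : ∀ k, 1 ≤ k → k < t → ∏ r ∈ Finset.Ico 1 k, Y r ω < x := by
    intro k hk1 hkt
    have := hmin k hkt
    rw [not_and] at this
    exact not_le.1 (this (Finset.mem_Icc.2 ⟨hk1, by omega⟩))
  have hsplit : ∏ s ∈ Finset.Ico 1 (T + 1), Z s ω = ∏ s ∈ Finset.Ico 1 t, Y s ω := by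
    rw [← Finset.prod_Ico_consecutive _ ht1.1 ht1.2]
    have e1 : ∏ s ∈ Finset.Ico 1 t, Z s ω = ∏ s ∈ Finset.Ico 1 t, Y s ω := by
      refine Finset.prod_congr rfl fun s hs => ?_
      rw [Finset.mem_Ico] at hs
      have : ω ∈ A s := fun k hk => hlt k (Finset.mem_Icc.1 hk).1
        (lt_of_le_of_lt (Finset.mem_Icc.1 hk).2 hs.2)
      simp [Z, this]
    have e2 : ∏ s ∈ Finset.Ico t (T + 1), Z s ω = 1 := by
      refine Finset.prod_eq_one fun s hs => ?_
      rw [Finset.mem_Ico] at hs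
      have : ω ∉ A s := fun h => absurd (h t (Finset.mem_Icc.2 ⟨ht1.1, hs.1⟩)) (not_lt.2 hx)
      simp [Z, this]
    rw [e1, e2, mul_one]
  rw [hsplit]
  exact hx

end Products

/-! ### Counting with the eluder dimension -/

section Eluder

variable {A : Type*} {F : Set (A → ℝ)} {ε₀ ε : ℝ} {d : ℕ}

/-- A sequence each of whose elements is independent of its predecessors is no longer than the
eluder dimension; here the sequence is indexed by a finite set of rounds. -/
lemma card_le_of_not_epsDependent (hd : eluderDim F ε₀ = d) (hε : ε₀ ≤ ε) (b : ℕ → A)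
    (J : Finset ℕ) (h : ∀ t ∈ J, ¬ EpsDependent F ε b {s ∈ J | s < t} (b t)) : J.card ≤ d := by
  let e := J.orderEmbOfFin rfl
  have key : ∀ k : Fin J.card, ¬ EpsDependent F ε (b ∘ e) (Finset.Iio k) ((b ∘ e) k) := by
    intro k hk
    refine h (e k) (J.orderEmbOfFin_mem rfl k) fun f hf g hg hs => hk f hf g hg ?_
    have himg : (Finset.Iio k).map e.toEmbedding = {s ∈ J | s < e k} := by
      ext s
      simp only [Finset.mem_map, Finset.mem_Iio, Finset.mem_filter]
      constructor
      · rintro ⟨i, hi, rfl⟩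
        exact ⟨J.orderEmbOfFin_mem rfl i, e.lt_iff_lt.2 hi⟩
      · rintro ⟨hsJ, hlt⟩
        have : s ∈ Set.range e := by rw [Finset.range_orderEmbOfFin]; exact hsJ
        obtain ⟨i, rfl⟩ := this
        exact ⟨i, e.lt_iff_lt.1 hlt, rfl⟩
    rwa [← himg, Finset.sum_map] at hs
  have h1 : (J.card : ℕ∞) ≤ eluderDim F ε₀ :=
    le_iSup_of_le J.card (le_iSup_of_le (b ∘ e) (le_iSup_of_le ⟨ε, hε, key⟩ le_rfl))
  rw [hd] at h1
  exact_mod_cast h1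

/-- Greedy distribution of the rounds into `m` classes: either some round depends on its
predecessors in each of the classes, or every round can be put into a class in which it is
independent of its predecessors. -/
lemma exists_coloring (F : Set (A → ℝ)) (ε : ℝ) (b : ℕ → A) (m : ℕ) [NeZero m] (J : Finset ℕ) :
    (∃ t ∈ J, ∃ c : ℕ → Fin m, ∀ i, EpsDependent F ε b {s ∈ J | s < t ∧ c s = i} (b t)) ∨
      ∃ c : ℕ → Fin m, ∀ t ∈ J, ¬ EpsDependent F ε b {s ∈ J | s < t ∧ c s = c t} (b t) := by
  induction J using Finset.induction_on_max with
  | empty => exact Or.inr ⟨fun _ => 0, by simp⟩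
  | insert a J hlt ih =>
    have hJ : ∀ t ∈ J, ∀ p : ℕ → Prop, [DecidablePred p] →
        {s ∈ insert a J | s < t ∧ p s} = {s ∈ J | s < t ∧ p s} := by
      intro t ht p _
      ext s
      simp only [Finset.mem_filter, Finset.mem_insert]
      constructor
      · rintro ⟨rfl | hs, h1, h2⟩
        · exact absurd (hlt t ht) (by omega)
        · exact ⟨hs, h1, h2⟩
      · rintro ⟨hs, h⟩
        exact ⟨Or.inr hs, h⟩
    rcases ih with ⟨t, ht, c, hc⟩ | ⟨c, hc⟩
    · refine Or.inl ⟨t, Finset.mem_insert_of_mem ht, c, fun i => ?_⟩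
      rw [hJ t ht]
      exact hc i
    · have ha : ∀ c' : ℕ → Fin m, (∀ s ∈ J, c' s = c s) → ∀ i,
          {s ∈ insert a J | s < a ∧ c' s = i} = {s ∈ J | c s = i} := by
        intro c' hc' i
        ext s
        simp only [Finset.mem_filter, Finset.mem_insert]
        constructor
        · rintro ⟨rfl | hs, h1, h2⟩
          · exact absurd h1 (lt_irrefl _)
          · exact ⟨hs, (hc' s hs) ▸ h2⟩
        · rintro ⟨hs, h⟩
          exact ⟨Or.inr hs, hlt s hs, (hc' s hs).trans h⟩
      by_cases hdep : ∀ i, EpsDependent F ε b {s ∈ J | c s = i} (b a)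
      · refine Or.inl ⟨a, Finset.mem_insert_self a J, c, fun i => ?_⟩
        rw [ha c (fun _ _ => rfl)]
        exact hdep i
      · push Not at hdep
        obtain ⟨i, hi⟩ := hdep
        have hne : ∀ s ∈ J, s ≠ a := fun s hs => (hlt s hs).ne
        have hupd : ∀ s ∈ J, Function.update c a i s = c s := fun s hs =>
          Function.update_of_ne (hne s hs) _ _
        refine Or.inr ⟨Function.update c a i, fun t ht => ?_⟩
        rcases Finset.mem_insert.1 ht with rfl | ht
        · rw [ha _ hupd, Function.update_self]
          exact hi
        · rw [hJ t ht, hupd t ht]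
          convert hc t ht using 2
          refine Finset.filter_congr fun s hs => ?_
          rw [hupd s hs]

/-- If in each of the rounds of `J` some function deviates from `g` by more than `ε` although its
squared deviations in the earlier rounds sum to at most `m ε²`, then `J` has at most `m d`
elements, where `d` is the eluder dimension. -/
lemma card_le_mul_eluderDim (hd : eluderDim F ε₀ = d) (hε : ε₀ ≤ ε) (hε0 : 0 ≤ ε) (b : ℕ → A)
    (J : Finset ℕ) {g : A → ℝ} (hg : g ∈ F) {m : ℕ} (hm : m ≠ 0)
    (h : ∀ t ∈ J, ∃ f ∈ F, ε < f (b t) - g (b t) ∧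
      ∑ s ∈ J with s < t, (f (b s) - g (b s)) ^ 2 ≤ m * ε ^ 2) : J.card ≤ m * d := by
  have : NeZero m := ⟨hm⟩
  rcases exists_coloring F ε b m J with ⟨t, ht, c, hc⟩ | ⟨c, hc⟩
  · exfalso
    obtain ⟨f, hf, hgt, hsum⟩ := h t ht
    have hi : ∀ i : Fin m, ε ^ 2 < ∑ s ∈ J with s < t ∧ c s = i, (f (b s) - g (b s)) ^ 2 := by
      intro i
      by_contra hle
      exact absurd (hc i f hf g hg (Real.sqrt_le_iff.2 ⟨hε0, not_lt.1 hle⟩)) (not_le.2 hgt)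
    have hfib : ∑ i : Fin m, ∑ s ∈ J with s < t ∧ c s = i, (f (b s) - g (b s)) ^ 2
        = ∑ s ∈ J with s < t, (f (b s) - g (b s)) ^ 2 := by
      rw [← Finset.sum_fiberwise {s ∈ J | s < t} c]
      simp only [Finset.filter_filter]
    have hlt : ∑ _i : Fin m, ε ^ 2
        < ∑ i : Fin m, ∑ s ∈ J with s < t ∧ c s = i, (f (b s) - g (b s)) ^ 2 :=
      Finset.sum_lt_sum_of_nonempty Finset.univ_nonempty fun i _ => hi i
    rw [hfib, Finset.sum_const, Finset.card_univ, Fintype.card_fin, nsmul_eq_mul] at hlt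
    linarith
  · have hclass : ∀ i : Fin m, ({s ∈ J | c s = i} : Finset ℕ).card ≤ d := by
      intro i
      refine card_le_of_not_epsDependent hd hε b _ fun t ht => ?_
      rw [Finset.mem_filter] at ht
      have := hc t ht.1
      rw [ht.2] at this
      convert this using 2
      ext s
      simp only [Finset.mem_filter]
      tauto
    rw [Finset.card_eq_sum_card_fiberwise (f := c) (t := Finset.univ) (fun _ _ => by simp)]
    calc _ ≤ ∑ _i : Fin m, d := Finset.sum_le_sum fun i _ => hclass i
      _ = m * d := by simp

end Eluder

/-! ### Least-squares confidence sets -/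

section Confidence

/-- The deterministic part of the confidence bound. Here `v` is the deviation of the least-squares
estimate from the true function, `v + h` that of a nearby member of the cover, and `e` the noise.
The crude bound `∑ v² ≤ 4 ∑ e²` settles the case of noise that is small compared with the
discretization error `α`; otherwise, the cost of passing to the cover is paid by the second term
of the radius. -/
lemma sum_sq_le_of_leastSquares {ι : Type*} (I : Finset ι) (v h e : ι → ℝ) {α S Λ M C t : ℝ}
    (hα : 0 ≤ α) (hS : 0 ≤ S) (hΛ : 0 ≤ Λ) (hC : 0 ≤ C) (hh : ∀ i ∈ I, |h i| ≤ α)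
    (hls : ∑ i ∈ I, (v i - e i) ^ 2 ≤ ∑ i ∈ I, e i ^ 2)
    (hcov : ∑ i ∈ I, (4 * ((v i + h i) * e i) - (v i + h i) ^ 2) ≤ 8 * S ^ 2 * Λ)
    (hn : (I.card : ℝ) + 1 ≤ t)
    (hQ : (t - 1) * ∑ i ∈ I, e i ^ 2 ≤ 2 / 3 * (S * √M * t) ^ 2) :
    ∑ i ∈ I, v i ^ 2 ≤ 8 * S ^ 2 * Λ + 4 * t * α * (C + √(S ^ 2 * M)) := by
  have hsqrt : √(S ^ 2 * M) = S * √M := by rw [Real.sqrt_mul (sq_nonneg S), Real.sqrt_sq hS]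
  have hn0 : (0 : ℝ) ≤ I.card := Nat.cast_nonneg _
  have ht : 0 ≤ t := by linarith
  set w := S * √M * t with hw
  have hw0 : 0 ≤ w := by positivity
  set Q := ∑ i ∈ I, e i ^ 2 with hQdef
  have hQ0 : 0 ≤ Q := Finset.sum_nonneg fun i _ => sq_nonneg _
  have hgoal : 8 * S ^ 2 * Λ + 4 * (α * w) ≤ 8 * S ^ 2 * Λ + 4 * t * α * (C + √(S ^ 2 * M)) := by
    rw [hsqrt]
    have : 0 ≤ t * α * C := by positivity
    nlinarith
  have hΛ' : 0 ≤ 8 * S ^ 2 * Λ := by positivity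
  refine le_trans ?_ hgoal
  rcases le_or_gt Q (α * w) with hsmall | hbig
  · have h1 : ∑ i ∈ I, v i ^ 2 ≤ ∑ i ∈ I, (2 * (v i - e i) ^ 2 + 2 * e i ^ 2) :=
      Finset.sum_le_sum fun i _ => by nlinarith [sq_nonneg (v i - 2 * e i)]
    rw [Finset.sum_add_distrib, ← Finset.mul_sum, ← Finset.mul_sum] at h1
    linarith
  · have hnQ : (I.card : ℝ) * Q ≤ 2 / 3 * w ^ 2 :=
      le_trans (mul_le_mul_of_nonneg_right (by linarith) hQ0) hQ
    -- `5 / 6` is a rational upper bound of `√(2 / 3)`; the three error terms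
    -- `5 / 3 + 5 / 3 + 2 / 3` then add up to exactly the `4` of the radius
    have habs : ∀ x : ι → ℝ, ∑ i ∈ I, x i ^ 2 ≤ Q → ∑ i ∈ I, |x i| ≤ 5 / 6 * w := by
      intro x hx
      refine abs_le_of_sq_le_sq' ?_ (by positivity) |>.2
      have h1 := sq_sum_le_card_mul_sum_sq (s := I) (f := fun i => |x i|)
      simp only [sq_abs] at h1
      have h2 : (I.card : ℝ) * ∑ i ∈ I, x i ^ 2 ≤ I.card * Q := by gcongr
      nlinarith [sq_nonneg w]
    have hmul : ∀ x : ι → ℝ, ∑ i ∈ I, x i ^ 2 ≤ Q → ∑ i ∈ I, h i * x i ≤ α * (5 / 6 * w) := by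
      intro x hx
      calc ∑ i ∈ I, h i * x i ≤ ∑ i ∈ I, α * |x i| := Finset.sum_le_sum fun i hi => by
            refine (le_abs_self _).trans ?_
            rw [abs_mul]
            exact mul_le_mul_of_nonneg_right (hh i hi) (abs_nonneg _)
        _ = α * ∑ i ∈ I, |x i| := (Finset.mul_sum _ _ _).symm
        _ ≤ _ := mul_le_mul_of_nonneg_left (habs x hx) hα
    have hsq : ∑ i ∈ I, h i ^ 2 ≤ α * (2 / 3 * w) := by
      have h1 : ∑ i ∈ I, h i ^ 2 ≤ I.card * α ^ 2 := by
        rw [← nsmul_eq_mul]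
        exact Finset.sum_le_card_nsmul _ _ _ fun i hi => by
          rw [← sq_abs]; exact pow_le_pow_left₀ (abs_nonneg _) (hh i hi) 2
      refine h1.trans ?_
      rcases hw0.eq_or_lt with hw00 | hwpos
      · -- without room for the noise there are no data
        rw [← hw00] at hnQ hbig ⊢
        have : (I.card : ℝ) = 0 := by
          by_contra hne
          have : 0 < (I.card : ℝ) := lt_of_le_of_ne hn0 (Ne.symm hne)
          nlinarith
        simp [this]
      · have h2 : (I.card : ℝ) * (α * w) ≤ 2 / 3 * w ^ 2 :=
          (mul_le_mul_of_nonneg_left hbig.le hn0).trans hnQ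
        have h3 : (I.card : ℝ) * α ≤ 2 / 3 * w := by
          by_contra hlt
          nlinarith
        nlinarith
    have hA := hmul (fun i => v i - e i) hls
    have hB := hmul (fun i => -e i) (by simp [hQdef])
    have hid : ∑ i ∈ I, v i ^ 2 = ∑ i ∈ I, (4 * ((v i + h i) * e i) - (v i + h i) ^ 2)
        + (2 * ∑ i ∈ I, (v i - e i) ^ 2 - 2 * ∑ i ∈ I, e i ^ 2) + 2 * ∑ i ∈ I, h i * (v i - e i)
        + 2 * ∑ i ∈ I, h i * -e i + ∑ i ∈ I, h i ^ 2 := by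
      simp only [Finset.mul_sum, ← Finset.sum_add_distrib, ← Finset.sum_sub_distrib]
      exact Finset.sum_congr rfl fun i _ => by ring
    rw [hid]
    linarith

/-- A finite set of centers realizing the covering number. -/
lemma exists_finset_cover {A : Type*} {F : Set (A → ℝ)} {α : ℝ≥0} {N : ℕ}
    (hN : coverNum F α = N) : ∃ G : Finset (A → ℝ), G.card ≤ N ∧ (∀ g ∈ G, g ∈ F) ∧
      ∀ f ∈ F, ∃ g ∈ G, ∀ a, |f a - g a| ≤ α := by
  classical
  have hne : Metric.coveringNumber α (UniformFun.ofFun '' F) ≠ ⊤ := by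
    change coverNum F α ≠ ⊤
    simp [hN]
  obtain ⟨D, hDF, hfin, hcov, hcard⟩ := Metric.exists_set_encard_eq_coveringNumber hne
  refine ⟨hfin.toFinset.image UniformFun.toFun, ?_, ?_, ?_⟩
  · refine Finset.card_image_le.trans ?_
    have h1 : (hfin.toFinset.card : ℕ∞) = N := by
      rw [← Set.Finite.encard_eq_coe_toFinset_card, hcard]
      exact hN
    exact_mod_cast h1.le
  · intro g hg
    obtain ⟨g', hg', rfl⟩ := Finset.mem_image.1 hg
    obtain ⟨f, hf, rfl⟩ := hDF (hfin.mem_toFinset.1 hg')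
    exact hf
  · intro f hf
    obtain ⟨g, hg, hfg⟩ := hcov (Set.mem_image_of_mem _ hf)
    refine ⟨_, Finset.mem_image_of_mem _ (hfin.mem_toFinset.2 hg), fun a => ?_⟩
    have h1 := UniformFun.edist_le.1 hfg a
    rw [edist_nndist, ENNReal.coe_le_coe, ← NNReal.coe_le_coe, coe_nndist, Real.dist_eq] at h1
    exact h1

variable {A Ω : Type*} {mΩ : MeasurableSpace Ω} {P : Measure Ω}
  {𝓖 : Filtration ℕ mΩ} {X : Interaction A Ω} {Y : Learner A Ω} {F : Set (A → ℝ)}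
  {fstar : A → ℝ} {T L : ℕ} {R σbar : ℝ} {β : ℕ → ℕ → ℝ}

lemma Learner.IsML2.sd_le (hY : Y.IsML2 X 𝓖 F fstar T L σbar β) {t l : ℕ} {ω : Ω}
    (ht : t ∈ Finset.Icc 1 T) (hl : Y.level t ω = l) : X.sd t ω ≤ 2 ^ (l + 1) * σbar :=
  hl ▸ (le_max_right _ _).trans (hY.le_level t ht ω)

lemma prod_Ico_ite_eq_exp (Y : Learner A Ω) (x : ℕ → Ω → ℝ) (t l : ℕ) (ω : Ω) :
    ∏ s ∈ Finset.Ico 1 t, (if Y.level s ω = l then ENNReal.ofReal (Real.exp (x s ω)) else 1)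
      = ENNReal.ofReal (Real.exp (∑ s ∈ Y.indexSet t l ω, x s ω)) := by
  rw [← Finset.prod_filter, ← ENNReal.ofReal_prod_of_nonneg fun s _ => (Real.exp_pos _).le,
    ← Real.exp_sum]
  rfl

variable [MeasurableSpace A]

lemma Interaction.IsBandit.weightedSubGaussian [IsProbabilityMeasure P]
    (hX : X.IsBandit fstar P 𝓖 T R) {t : ℕ} (ht : t ∈ Finset.Icc 1 T) :
    WeightedSubGaussian (𝓖 t) P (X.noise t) (X.sd t) :=
  weightedSubGaussian_of_condExp_le (𝓖.le t)
    ((hX.measurable_noise t ht).mono (𝓖.le _) le_rfl) (hX.measurable_sd t ht)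
    (hX.integrable_exp t ht) (hX.subGaussian t ht)

/-- Uniformly in time, the squared distance of a fixed function `g` from the true one is
controlled by the excess loss of `g`. -/
lemma measure_excess_loss_le [IsProbabilityMeasure P] (hX : X.IsBandit fstar P 𝓖 T R)
    (hY : Y.IsML2 X 𝓖 F fstar T L σbar β) (hσ : 0 < σbar) {g : A → ℝ} (hg : Measurable g)
    (hf : Measurable fstar) (l : ℕ) (Λ : ℝ) :
    P {ω | ∃ t ∈ Finset.Icc 1 T, 8 * (2 ^ (l + 1) * σbar) ^ 2 * Λ
      < ∑ s ∈ Y.indexSet t l ω, (4 * ((g (X.act s ω) - fstar (X.act s ω)) * X.noise s ω)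
        - (g (X.act s ω) - fstar (X.act s ω)) ^ 2)} ≤ ENNReal.ofReal (Real.exp (-Λ)) := by
  set S := 2 ^ (l + 1) * σbar with hSdef
  have hS : 0 < S := by positivity
  let D : ℕ → Ω → ℝ := fun s ω => g (X.act s ω) - fstar (X.act s ω)
  have hD : ∀ s ∈ Finset.Icc 1 T, Measurable[𝓖 s] (D s) := fun s hs =>
    (hg.comp (hX.measurable_act s hs)).sub (hf.comp (hX.measurable_act s hs))
  have hlev : ∀ s ∈ Finset.Icc 1 T, MeasurableSet[𝓖 s] {ω | Y.level s ω = l} := fun s hs =>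
    hY.measurable_level s hs (measurableSet_singleton l)
  let x : ℕ → Ω → ℝ := fun s ω => (4 * (D s ω * X.noise s ω) - D s ω ^ 2) / (8 * S ^ 2)
  let Z : ℕ → Ω → ℝ≥0∞ := fun s ω =>
    if Y.level s ω = l then ENNReal.ofReal (Real.exp (x s ω)) else 1
  have hZ : ∀ s ∈ Finset.Icc 1 T, Measurable[𝓖 (s + 1)] (Z s) := by
    intro s hs
    have h1 : Measurable[𝓖 (s + 1)] (D s) := (hD s hs).mono (𝓖.mono (Nat.le_succ s)) le_rfl
    have h2 := hX.measurable_noise s hs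
    have h3 : Measurable[𝓖 (s + 1)] (x s) := by fun_prop
    exact Measurable.ite (𝓖.mono (Nat.le_succ s) _ (hlev s hs))
      (h3.exp.ennreal_ofReal) measurable_const
  have hc : ∀ s ∈ Finset.Icc 1 T, ∀ W : Ω → ℝ≥0∞, Measurable[𝓖 s] W →
      ∫⁻ ω, W ω * Z s ω ∂P ≤ ∫⁻ ω, W ω ∂P := by
    intro s hs W hW
    -- the moment parameter vanishes off level `l`, where `σ_s ≤ S` may fail
    have hu : Measurable[𝓖 s] fun ω => if Y.level s ω = l then D s ω / (2 * S ^ 2) else 0 :=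
      Measurable.ite (hlev s hs) ((hD s hs).div_const _) measurable_const
    refine le_trans (lintegral_mono fun ω => ?_) (hX.weightedSubGaussian hs _ W hu hW)
    by_cases hω : Y.level s ω = l
    · simp only [Z, hω, if_true]
      gcongr
      have h1 : X.sd s ω ^ 2 ≤ S ^ 2 :=
        pow_le_pow_left₀ (hX.sd_nonneg s hs ω) (hY.sd_le hs hω) 2
      have h2 : x s ω = D s ω / (2 * S ^ 2) * X.noise s ω
          - (D s ω / (2 * S ^ 2)) ^ 2 * S ^ 2 / 2 := by
        simp only [x]
        field_simp
        ring
      rw [h2]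
      gcongr
    · simp [Z, hω]
  have hV := mul_measure_exists_le_prod_Ico_le_one hZ hc (ENNReal.ofReal (Real.exp Λ))
  rw [Real.exp_neg, ENNReal.ofReal_inv_of_pos (Real.exp_pos _), ENNReal.le_inv_iff_mul_le, mul_comm]
  refine le_trans (mul_le_mul_right (measure_mono fun ω hω => ?_) _) hV
  obtain ⟨t, ht, hlt⟩ := hω
  refine ⟨t, Finset.Icc_subset_Icc_right (Nat.le_succ T) ht, ?_⟩
  rw [prod_Ico_ite_eq_exp]
  refine ENNReal.ofReal_le_ofReal (Real.exp_le_exp.2 ?_)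
  simp only [x, ← Finset.sum_div]
  rw [le_div_iff₀ (by positivity)]
  simp only [D]
  linarith

/-- Tail bound for the noise of level `l` in the first `k` rounds: each factor `exp (3 e² / (8 S²))`
has conditional mean at most `2`. -/
lemma measure_sum_sq_noise_le [IsProbabilityMeasure P] (hX : X.IsBandit fstar P 𝓖 T R)
    (hY : Y.IsML2 X 𝓖 F fstar T L σbar β) (hσ : 0 < σbar) (l : ℕ) (θ : ℝ) {k : ℕ} (hk : k ≤ T) :
    P {ω | θ < ∑ s ∈ Y.indexSet (k + 1) l ω, 3 * X.noise s ω ^ 2 / (8 * (2 ^ (l + 1) * σbar) ^ 2)}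
      ≤ ENNReal.ofReal (2 ^ k * Real.exp (-θ)) := by
  set S := 2 ^ (l + 1) * σbar with hSdef
  have hS : 0 < S := by positivity
  have hlev : ∀ s ∈ Finset.Icc 1 T, MeasurableSet[𝓖 s] {ω | Y.level s ω = l} := fun s hs =>
    hY.measurable_level s hs (measurableSet_singleton l)
  let x : ℕ → Ω → ℝ := fun s ω => 3 * X.noise s ω ^ 2 / (8 * S ^ 2)
  let Z : ℕ → Ω → ℝ≥0∞ := fun s ω =>
    if Y.level s ω = l then ENNReal.ofReal (Real.exp (x s ω)) else 1
  have hZ : ∀ s ∈ Finset.Icc 1 T, Measurable[𝓖 (s + 1)] (Z s) := by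
    intro s hs
    have h2 := hX.measurable_noise s hs
    have h3 : Measurable[𝓖 (s + 1)] (x s) := by fun_prop
    exact Measurable.ite (𝓖.mono (Nat.le_succ s) _ (hlev s hs))
      (h3.exp.ennreal_ofReal) measurable_const
  have hc : ∀ s ∈ Finset.Icc 1 T, ∀ W : Ω → ℝ≥0∞, Measurable[𝓖 s] W →
      ∫⁻ ω, W ω * Z s ω ∂P ≤ 2 * ∫⁻ ω, W ω ∂P := by
    intro s hs W hW
    set G : Set Ω := {ω | Y.level s ω = l} with hGdef
    have hG := hlev s hs
    have hG' : MeasurableSet G := 𝓖.le s _ hG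
    rw [← lintegral_add_compl (fun ω => W ω * Z s ω) hG', ← lintegral_add_compl W hG', mul_add]
    have hnoise : Measurable (X.noise s) := (hX.measurable_noise s hs).mono (𝓖.le _) le_rfl
    refine add_le_add ?_ ?_
    · refine le_trans (le_of_eq ?_) ((hX.weightedSubGaussian hs).lintegral_mul_exp_sq_le (𝓖.le s)
        hnoise (hX.measurable_sd s hs) (hX.sd_nonneg s hs) hS hG
        (fun ω hω => hY.sd_le hs hω) hW)
      rw [← lintegral_indicator hG']
      refine lintegral_congr fun ω => ?_
      by_cases hω : ω ∈ G
      · have : Y.level s ω = l := hω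
        simp [hω, Z, this, x]
      · have : ¬ Y.level s ω = l := hω
        simp [hω, this]
    · calc ∫⁻ ω in Gᶜ, W ω * Z s ω ∂P = ∫⁻ ω in Gᶜ, W ω ∂P := by
            refine setLIntegral_congr_fun hG'.compl fun ω hω => ?_
            have : ¬ Y.level s ω = l := hω
            simp [Z, this]
        _ ≤ 2 * ∫⁻ ω in Gᶜ, W ω ∂P := le_mul_of_one_le_left' one_le_two
  have hint := lintegral_prod_Ico_le (P := P) hZ hc hk
  have hmk := mul_meas_ge_le_lintegral
    ((measurable_prod_Ico hZ (t := k + 1) (by omega)).mono (𝓖.le _) le_rfl)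
    (ENNReal.ofReal (Real.exp θ)) (μ := P)
  rw [Real.exp_neg, ENNReal.ofReal_mul (by positivity), ENNReal.ofReal_inv_of_pos (Real.exp_pos _),
    ENNReal.ofReal_pow zero_le_two, ENNReal.ofReal_ofNat, ← div_eq_mul_inv,
    ENNReal.le_div_iff_mul_le (by simp [Real.exp_pos]) (by simp), mul_comm]
  refine le_trans (mul_le_mul_right (measure_mono fun ω hω => ?_) _) (hmk.trans hint)
  simp only [Set.mem_ofPred_eq] at hω ⊢
  rw [prod_Ico_ite_eq_exp]
  exact ENNReal.ofReal_le_ofReal (Real.exp_le_exp.2 hω.le)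

end Confidence

/-! ### Coverage of the true function -/

section Coverage

/-- The failure probability of the noise bound in the round after `k` observations; the exponent
is that of the noise threshold used in the confidence bound. -/
lemma two_pow_mul_exp_le {k : ℕ} (hk : k ≠ 0) {M : ℝ} (hM : 4 * Real.log 2 ≤ M) :
    2 ^ k * Real.exp (-(((k : ℝ) + 1) ^ 2 * M / (4 * k))) ≤ 4 * Real.exp (-M) := by
  have hk1 : (1 : ℝ) ≤ k := by exact_mod_cast Nat.one_le_iff_ne_zero.2 hk
  have hk0 : (0 : ℝ) < k := by linarith
  have h2 : (2 : ℝ) ^ k = Real.exp (k * Real.log 2) := by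
    rw [Real.exp_nat_mul, Real.exp_log two_pos]
  have h4 : (4 : ℝ) = Real.exp (2 * Real.log 2) := by
    rw [two_mul, Real.exp_add, Real.exp_log two_pos]; norm_num
  rw [h2, ← Real.exp_add]
  nth_rw 2 [h4]
  rw [← Real.exp_add, Real.exp_le_exp]
  have hlog : 0 < Real.log 2 := Real.log_pos one_lt_two
  have h5 : ((k : ℝ) + 1) ^ 2 * M / (4 * k) = M + (k - 1) ^ 2 * M / (4 * k) := by
    field_simp
    ring
  have h6 : ((k : ℝ) - 2) * Real.log 2 ≤ (k - 1) ^ 2 * M / (4 * k) := by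
    rw [le_div_iff₀ (by positivity)]
    nlinarith [mul_le_mul_of_nonneg_left hM (sq_nonneg ((k : ℝ) - 1))]
  rw [h5]
  linarith

lemma sum_inv_mul_succ_le (T : ℕ) :
    ∑ t ∈ Finset.Icc 2 T, ((t : ℝ) * (t + 1))⁻¹ ≤ 1 / 2 := by
  have h : ∀ n : ℕ, ∑ t ∈ Finset.Ico 2 (n + 2), ((t : ℝ) * (t + 1))⁻¹ = 1 / 2 - 1 / (n + 2) := by
    intro n
    induction n with
    | zero => simp
    | succ n ih =>
      rw [show n + 1 + 2 = (n + 2) + 1 by ring, Finset.sum_Ico_succ_top (by omega), ih]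
      push_cast
      field_simp
      ring
  calc _ ≤ ∑ t ∈ Finset.Ico 2 (T + 2), ((t : ℝ) * (t + 1))⁻¹ :=
        Finset.sum_le_sum_of_subset_of_nonneg
          (fun t ht => by rw [Finset.mem_Icc] at ht; exact Finset.mem_Ico.2 (by omega))
          fun _ _ _ => by positivity
    _ ≤ 1 / 2 := by
        rw [h]
        have : (0 : ℝ) ≤ 1 / ((T : ℝ) + 2) := by positivity
        linarith

variable {A Ω : Type*} {mΩ : MeasurableSpace Ω} {P : Measure Ω}
  {𝓖 : Filtration ℕ mΩ} {X : Interaction A Ω} {Y : Learner A Ω} {F : Set (A → ℝ)}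
  {fstar : A → ℝ} {T L N : ℕ} {R C σbar δ : ℝ} {α : ℝ≥0} {β : ℕ → ℕ → ℝ}

/-- The true function lies in the confidence set of level `l` at time `t` if its excess loss
against the centers of a cover and the noise of the level are both controlled. -/
lemma mem_confSet_of_excess_loss_le (hY : Y.IsML2 X 𝓖 F fstar T L σbar β) (hσ : 0 < σbar)
    (hδ : 0 < δ) (hδ1 : δ < 1) (hN : 1 ≤ N) (hC : 0 ≤ C) (hfF : fstar ∈ F)
    {G : Finset (A → ℝ)} (hG : ∀ f ∈ F, ∃ g ∈ G, ∀ a, |f a - g a| ≤ α)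
    {t l : ℕ} (ht : t ∈ Finset.Icc 1 T) (hl : l < L) {ω : Ω}
    (hcov : ∀ g ∈ G, ∑ s ∈ Y.indexSet t l ω,
      (4 * ((g (X.act s ω) - fstar (X.act s ω)) * X.noise s ω)
        - (g (X.act s ω) - fstar (X.act s ω)) ^ 2)
      ≤ 8 * (2 ^ (l + 1) * σbar) ^ 2 * Real.log (2 * N * L / δ))
    (hnoise : ((t : ℝ) - 1) * ∑ s ∈ Y.indexSet t l ω, X.noise s ω ^ 2
      ≤ 2 / 3 * (2 ^ (l + 1) * σbar * √(Real.log (4 * t * (t + 1) * L / δ)) * t) ^ 2) :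
    fstar ∈ Y.confSet X F (radius C σbar α δ N L t l) t l ω := by
  obtain ⟨g, hg, hgα⟩ := hG _ (hY.est_mem t ht l hl ω)
  have ht' := Finset.mem_Icc.1 ht
  have hL : (1 : ℝ) ≤ L := by exact_mod_cast (by omega : 1 ≤ L)
  have hN' : (1 : ℝ) ≤ N := by exact_mod_cast hN
  have hΛ : 0 ≤ Real.log (2 * N * L / δ) := by
    refine Real.log_nonneg ?_
    rw [le_div_iff₀ hδ]
    nlinarith [mul_le_mul hN' hL zero_le_one (by linarith)]
  have hcard : ((Y.indexSet t l ω).card : ℝ) + 1 ≤ t := by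
    have h1 : (Y.indexSet t l ω).card ≤ t - 1 := by
      have := Finset.card_filter_le (Finset.Ico 1 t) (fun s => Y.level s ω = l)
      rwa [Nat.card_Ico] at this
    have h2 : (Y.indexSet t l ω).card + 1 ≤ t := by omega
    exact_mod_cast h2
  have hls := hY.est_min t ht l hl ω fstar hfF
  simp only [Learner.loss, Interaction.reward, sub_add_cancel_left, neg_sq] at hls
  have key := sum_sq_le_of_leastSquares (Y.indexSet t l ω)
    (fun s => Y.est t l ω (X.act s ω) - fstar (X.act s ω))
    (fun s => g (X.act s ω) - Y.est t l ω (X.act s ω)) (fun s => X.noise s ω)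
    (α := α) (S := 2 ^ (l + 1) * σbar) (Λ := Real.log (2 * N * L / δ))
    (M := Real.log (4 * t * (t + 1) * L / δ)) (C := C) (t := t) α.coe_nonneg (by positivity) hΛ hC
    (fun s _ => by rw [abs_sub_comm]; exact hgα _)
    (by simpa only [sub_sub] using hls)
    (by simpa only [sub_add_sub_cancel', add_comm, sub_add_sub_cancel] using hcov g hg)
    hcard hnoise
  have hnn := (Finset.sum_nonneg fun s (_ : s ∈ Y.indexSet t l ω) =>
    sq_nonneg (Y.est t l ω (X.act s ω) - fstar (X.act s ω))).trans key
  refine ⟨hfF, ?_⟩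
  rw [radius, Real.sq_sqrt hnn]
  refine le_trans (le_of_eq (Finset.sum_congr rfl fun s _ => ?_)) key
  ring

variable [MeasurableSpace A]

/-- With probability at least `1 - δ` the true function lies in all the confidence sets. Half of
`δ` pays for the members of the cover, the other half for the size of the noise. -/
lemma measure_exists_notMem_confSet_le [IsProbabilityMeasure P] (hF : ∀ f ∈ F, Measurable f)
    (hX : X.IsBandit fstar P 𝓖 T R) (hY : Y.IsML2 X 𝓖 F fstar T L σbar β) (hσ : 0 < σbar)
    (hδ : 0 < δ) (hδ1 : δ < 1) (hL : 1 ≤ L) (hN : coverNum F α = N) (hC : 0 ≤ C)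
    (hfF : fstar ∈ F) :
    P {ω | ∃ t ∈ Finset.Icc 1 T, ∃ l < L,
        fstar ∉ Y.confSet X F (radius C σbar α δ N L t l) t l ω} ≤ ENNReal.ofReal δ := by
  obtain ⟨G, hGN, hGF, hG⟩ := exists_finset_cover hN
  have hN1 : 1 ≤ N := by
    obtain ⟨g, hg, -⟩ := hG _ hfF
    exact (Finset.card_pos.2 ⟨g, hg⟩).trans_le hGN
  have hL' : (0 : ℝ) < L := by exact_mod_cast hL
  have hN' : (0 : ℝ) < N := by exact_mod_cast hN1
  let Λ := Real.log (2 * N * L / δ)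
  let M : ℕ → ℝ := fun t => Real.log (4 * t * (t + 1) * L / δ)
  let S : ℕ → ℝ := fun l => 2 ^ (l + 1) * σbar
  let E₁ : ℕ → (A → ℝ) → Set Ω := fun l g => {ω | ∃ t ∈ Finset.Icc 1 T, 8 * S l ^ 2 * Λ
      < ∑ s ∈ Y.indexSet t l ω, (4 * ((g (X.act s ω) - fstar (X.act s ω)) * X.noise s ω)
        - (g (X.act s ω) - fstar (X.act s ω)) ^ 2)}
  let E₂ : ℕ → ℕ → Set Ω := fun l t => {ω | 2 / 3 * (S l * √(M t) * t) ^ 2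
      < ((t : ℝ) - 1) * ∑ s ∈ Y.indexSet t l ω, X.noise s ω ^ 2}
  have hE₁ : ∀ l, ∀ g ∈ G, P (E₁ l g) ≤ ENNReal.ofReal (δ / (2 * N * L)) := by
    intro l g hg
    refine (measure_excess_loss_le hX hY hσ (hF g (hGF g hg)) (hF _ hfF) l Λ).trans (le_of_eq ?_)
    rw [Real.exp_neg, Real.exp_log (by positivity), inv_div]
  have hE₂ : ∀ l, ∀ t ∈ Finset.Icc 2 T, P (E₂ l t)
      ≤ ENNReal.ofReal (δ / L * ((t : ℝ) * (t + 1))⁻¹) := by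
    intro l t ht
    obtain ⟨ht2, htT⟩ := Finset.mem_Icc.1 ht
    obtain ⟨k, rfl⟩ : ∃ k, t = k + 1 := ⟨t - 1, by omega⟩
    have hk : k ≠ 0 := by omega
    have hk0 : (0 : ℝ) < k := by exact_mod_cast Nat.pos_of_ne_zero hk
    have hk1 : (1 : ℝ) ≤ k := by exact_mod_cast Nat.one_le_iff_ne_zero.2 hk
    have hM : 4 * Real.log 2 ≤ M (k + 1) := by
      have : 4 * Real.log 2 = Real.log (2 ^ 4) := by rw [Real.log_pow]; norm_num
      rw [this]
      refine Real.log_le_log (by norm_num) ?_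
      have h1 : (1 : ℝ) ≤ L := by exact_mod_cast hL
      have h2 : (24 : ℝ) ≤ 4 * ((k + 1 : ℕ) : ℝ) * (((k + 1 : ℕ) : ℝ) + 1) := by
        push_cast; nlinarith
      rw [le_div_iff₀ hδ]
      have h3 : (24 : ℝ) * 1 ≤ 4 * ((k + 1 : ℕ) : ℝ) * (((k + 1 : ℕ) : ℝ) + 1) * L :=
        mul_le_mul h2 h1 zero_le_one (by positivity)
      linarith
    have hM0 : 0 ≤ M (k + 1) := le_trans (by positivity) hM
    have hS : 0 < S l := by positivity
    have h1 := measure_sum_sq_noise_le hX hY hσ l (((k : ℝ) + 1) ^ 2 * M (k + 1) / (4 * k))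
      (k := k) (by omega)
    refine (measure_mono fun ω hω => ?_).trans (h1.trans (ENNReal.ofReal_le_ofReal
      ((two_pow_mul_exp_le hk hM).trans (le_of_eq ?_))))
    · simp only [E₂, Set.mem_ofPred_eq] at hω ⊢
      push_cast at hω
      rw [mul_pow, mul_pow, Real.sq_sqrt hM0, add_sub_cancel_right] at hω
      rw [← Finset.sum_div, ← Finset.mul_sum, div_lt_div_iff₀ (by positivity) (by positivity)]
      change _ * (8 * S l ^ 2) < _
      nlinarith
    · rw [Real.exp_neg, Real.exp_log (by positivity)]
      field_simp
  have hsub : {ω | ∃ t ∈ Finset.Icc 1 T, ∃ l < L,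
        fstar ∉ Y.confSet X F (radius C σbar α δ N L t l) t l ω}
      ⊆ ⋃ l ∈ Finset.range L, ((⋃ g ∈ G, E₁ l g) ∪ ⋃ t ∈ Finset.Icc 2 T, E₂ l t) := by
    rintro ω ⟨t, ht, l, hl, hnot⟩
    by_contra hcon
    simp only [Set.mem_iUnion, Set.mem_union, not_exists, not_or, Finset.mem_range] at hcon
    obtain ⟨h1, h2⟩ := hcon l hl
    refine hnot (mem_confSet_of_excess_loss_le hY hσ hδ hδ1 hN1 hC hfF hG ht hl
      (fun g hg => ?_) ?_)
    · by_contra hlt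
      exact h1 g hg ⟨t, ht, not_le.1 hlt⟩
    · rcases (Finset.mem_Icc.1 ht).1.eq_or_lt with rfl | ht2
      · norm_num
        positivity
      · by_contra hlt
        exact h2 t (Finset.mem_Icc.2 ⟨ht2, (Finset.mem_Icc.1 ht).2⟩) (not_le.1 hlt)
  calc _ ≤ _ := measure_mono hsub
    _ ≤ ∑ l ∈ Finset.range L, P ((⋃ g ∈ G, E₁ l g) ∪ ⋃ t ∈ Finset.Icc 2 T, E₂ l t) :=
        measure_biUnion_finset_le _ _
    _ ≤ ∑ _l ∈ Finset.range L, ENNReal.ofReal (δ / L) := by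
        refine Finset.sum_le_sum fun l _ => (measure_union_le _ _).trans ?_
        have h1 : P (⋃ g ∈ G, E₁ l g) ≤ ENNReal.ofReal (δ / (2 * L)) :=
          calc _ ≤ ∑ g ∈ G, P (E₁ l g) := measure_biUnion_finset_le _ _
            _ ≤ G.card • ENNReal.ofReal (δ / (2 * N * L)) :=
                Finset.sum_le_card_nsmul _ _ _ (hE₁ l)
            _ ≤ N • ENNReal.ofReal (δ / (2 * N * L)) := by gcongr
            _ = ENNReal.ofReal (δ / (2 * L)) := by
                rw [← ENNReal.ofReal_nsmul, nsmul_eq_mul]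
                congr 1
                field_simp
        have h2 : P (⋃ t ∈ Finset.Icc 2 T, E₂ l t) ≤ ENNReal.ofReal (δ / (2 * L)) :=
          calc _ ≤ ∑ t ∈ Finset.Icc 2 T, P (E₂ l t) := measure_biUnion_finset_le _ _
            _ ≤ ∑ t ∈ Finset.Icc 2 T, ENNReal.ofReal (δ / L * ((t : ℝ) * (t + 1))⁻¹) :=
                Finset.sum_le_sum (hE₂ l)
            _ = ENNReal.ofReal (δ / L * ∑ t ∈ Finset.Icc 2 T, ((t : ℝ) * (t + 1))⁻¹) := by
                rw [← ENNReal.ofReal_sum_of_nonneg fun t _ => by positivity, Finset.mul_sum]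
            _ ≤ ENNReal.ofReal (δ / L * (1 / 2)) := by
                gcongr
                exact sum_inv_mul_succ_le T
            _ = _ := by congr 1; field_simp
        refine (add_le_add h1 h2).trans (le_of_eq ?_)
        rw [← ENNReal.ofReal_add (by positivity) (by positivity)]
        congr 1
        field_simp
        norm_num
    _ = ENNReal.ofReal δ := by
        rw [Finset.sum_const, Finset.card_range, ← ENNReal.ofReal_nsmul, nsmul_eq_mul]
        congr 1
        field_simp

end Coverage

/-! ### From confidence sets to regret -/

section Regret

/-- A dyadic layer-cake estimate of a quantity that is either nonpositive or at least `Δ`. -/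
lemma le_two_mul_sum_dyadic {r Δ : ℝ} (hΔ : 0 ≤ Δ) (hr : r ≤ 0 ∨ Δ ≤ r) (n : ℕ)
    (hn : r < 2 ^ n * Δ) :
    r ≤ 2 * ∑ j ∈ Finset.range n, if 2 ^ j * Δ ≤ r then 2 ^ j * Δ else 0 := by
  induction n with
  | zero => simp at hn ⊢; rcases hr with h | h <;> linarith
  | succ n ih =>
    rw [Finset.sum_range_succ, mul_add]
    by_cases h : 2 ^ n * Δ ≤ r
    · rw [if_pos h]
      have h1 : 0 ≤ ∑ j ∈ Finset.range n, if 2 ^ j * Δ ≤ r then 2 ^ j * Δ else 0 :=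
        Finset.sum_nonneg fun j _ => by split_ifs <;> positivity
      rw [pow_succ] at hn
      linarith
    · rw [if_neg h, mul_zero, add_zero]
      exact ih (not_le.1 h)

/-- Quantities with a gap `Δ` of which at most `(b / x² + 1) d` exceed `x` sum to at most
`O(n (b / Δ + B) d)`, where `n` is the number of dyadic scales between `Δ` and the maximum `B`. -/
lemma sum_le_of_card_lt_le {J : Finset ℕ} {r : ℕ → ℝ} {Δ B b d : ℝ} (hΔ : 0 < Δ) (hB : 0 ≤ B)
    (hb : 0 ≤ b) (hd : 0 ≤ d) (hr : ∀ t ∈ J, r t ≤ 0 ∨ Δ ≤ r t) (hrB : ∀ t ∈ J, r t ≤ B)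
    (hcount : ∀ x, Δ / 2 ≤ x → (({t ∈ J | x < r t} : Finset ℕ).card : ℝ) ≤ (b / x ^ 2 + 1) * d)
    {n : ℕ} (hn : B < 2 ^ n * Δ) : ∑ t ∈ J, r t ≤ 2 * n * (4 * b / Δ + B) * d := by
  have hscale : ∀ j, ∑ t ∈ J, (if 2 ^ j * Δ ≤ r t then 2 ^ j * Δ else 0) ≤ (4 * b / Δ + B) * d := by
    intro j
    have hy : Δ ≤ 2 ^ j * Δ := le_mul_of_one_le_left hΔ.le (one_le_pow₀ one_le_two)
    set y := 2 ^ j * Δ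
    have hy0 : 0 < y := hΔ.trans_le hy
    have h0 : 0 ≤ (4 * b / Δ + B) * d := by positivity
    rw [← Finset.sum_filter, Finset.sum_const, nsmul_eq_mul]
    rcases ({t ∈ J | y ≤ r t} : Finset ℕ).eq_empty_or_nonempty with he | ⟨t, ht⟩
    · simpa [he] using h0
    · rw [Finset.mem_filter] at ht
      have hyB : y ≤ B := ht.2.trans (hrB t ht.1)
      have h1 : (({t ∈ J | y ≤ r t} : Finset ℕ).card : ℝ) ≤ (b / (y / 2) ^ 2 + 1) * d := by
        refine le_trans ?_ (hcount (y / 2) (by linarith))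
        exact_mod_cast Finset.card_le_card (Finset.monotone_filter_right J
          fun t _ (h : y ≤ r t) => (half_lt_self hy0).trans_le h)
      calc _ ≤ (b / (y / 2) ^ 2 + 1) * d * y := mul_le_mul_of_nonneg_right h1 hy0.le
        _ = (4 * b / y + y) * d := by field_simp; ring
        _ ≤ (4 * b / Δ + B) * d := by gcongr
  calc ∑ t ∈ J, r t
      ≤ ∑ t ∈ J, 2 * ∑ j ∈ Finset.range n, (if 2 ^ j * Δ ≤ r t then 2 ^ j * Δ else 0) :=
        Finset.sum_le_sum fun t ht =>
          le_two_mul_sum_dyadic hΔ.le (hr t ht) n ((hrB t ht).trans_lt hn)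
    _ = 2 * ∑ j ∈ Finset.range n, ∑ t ∈ J, (if 2 ^ j * Δ ≤ r t then 2 ^ j * Δ else 0) := by
        rw [← Finset.mul_sum, Finset.sum_comm]
    _ ≤ 2 * ∑ _j ∈ Finset.range n, (4 * b / Δ + B) * d := by
        gcongr with j
        exact hscale j
    _ = _ := by
        rw [Finset.sum_const, Finset.card_range, nsmul_eq_mul]
        ring

variable {A Ω : Type*} {mΩ : MeasurableSpace Ω}
  {𝓖 : Filtration ℕ mΩ} {X : Interaction A Ω} {Y : Learner A Ω} {F : Set (A → ℝ)}
  {fstar : A → ℝ} {T L N d : ℕ} {R C σbar δ : ℝ} {α : ℝ≥0} {β : ℕ → ℕ → ℝ} {ω : Ω}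

/-- A class of finite covering number is pointwise bounded, so that the suprema in the optimistic
index are not junk values. -/
lemma bddAbove_eval_confSet (hN : coverNum F α = N) (x : ℝ) (t l : ℕ) (a : A) :
    BddAbove (Set.range fun f : Y.confSet X F x t l ω => (f : A → ℝ) a) := by
  obtain ⟨G, -, -, hG⟩ := exists_finset_cover hN
  refine ⟨∑ g ∈ G, |g a| + α, ?_⟩
  rintro _ ⟨⟨f, hf⟩, rfl⟩
  obtain ⟨g, hg, hfg⟩ := hG f hf.1
  have h1 := (abs_le.1 (hfg a)).2
  have h2 := Finset.single_le_sum (f := fun g : A → ℝ => |g a|) (fun _ _ => abs_nonneg _) hg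
  have h3 := le_abs_self (g a)
  simp only at h2 ⊢
  linarith

/-- Optimism: if the true function lies in all the confidence sets of round `t`, the regret of the
round is at most the width of each of them at the chosen action. -/
lemma exists_mem_confSet_of_lt_regret (hN : coverNum F α = N)
    (hY : Y.IsML2 X 𝓖 F fstar T L σbar β) {t : ℕ} (ht : t ∈ Finset.Icc 1 T)
    (hbest : X.best t ω ∈ X.decision t ω)
    (hgood : ∀ l < L, fstar ∈ Y.confSet X F (β t l) t l ω) {l : ℕ} (hl : l < L) {x : ℝ}
    (hx : x < fstar (X.best t ω) - fstar (X.act t ω)) :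
    ∃ f ∈ Y.confSet X F (β t l) t l ω, x < f (X.act t ω) - fstar (X.act t ω) := by
  have : Nonempty (Fin L) := ⟨⟨l, hl⟩⟩
  have h1 : fstar (X.best t ω) ≤ Y.index X F β L t ω (X.best t ω) :=
    le_ciInf fun k => le_ciSup (f := fun f : Y.confSet X F (β t k) t k ω =>
      (f : A → ℝ) (X.best t ω)) (bddAbove_eval_confSet hN _ _ _ _) ⟨fstar, hgood k k.2⟩
  have h2 := hY.act_max t ht ω _ hbest
  have h3 : Y.index X F β L t ω (X.act t ω)
      ≤ ⨆ f : Y.confSet X F (β t l) t l ω, (f : A → ℝ) (X.act t ω) :=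
    ciInf_le (Set.finite_range _).bddBelow (⟨l, hl⟩ : Fin L)
  have : Nonempty (Y.confSet X F (β t l) t l ω) := ⟨⟨fstar, hgood l hl⟩⟩
  obtain ⟨f, hf⟩ := exists_lt_of_lt_ciSup (show x + fstar (X.act t ω)
    < ⨆ f : Y.confSet X F (β t l) t l ω, (f : A → ℝ) (X.act t ω) by linarith)
  exact ⟨f, f.2, by linarith⟩

/-- In the rounds of level `l` with regret above `x` optimism provides functions that deviate from
the true one by more than `x`, while membership in the confidence set of level `l` bounds their
deviations in the earlier rounds of that level; the eluder dimension limits the number of such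
rounds. -/
lemma card_lt_regret_le (hN : coverNum F α = N) {ε₀ : ℝ} (hd : eluderDim F ε₀ = d)
    (hY : Y.IsML2 X 𝓖 F fstar T L σbar β)
    (hbest : ∀ t ∈ Finset.Icc 1 T, X.best t ω ∈ X.decision t ω)
    (hgood : ∀ t ∈ Finset.Icc 1 T, ∀ l < L, fstar ∈ Y.confSet X F (β t l) t l ω)
    (hfF : fstar ∈ F) {l : ℕ} (hl : l < L) {x b : ℝ} (hx0 : 0 < x) (hx : ε₀ ≤ x)
    (hb : 0 ≤ b) (hβ : ∀ t ∈ Finset.Icc 1 T, Y.level t ω = l → β t l ^ 2 ≤ b) :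
    (({t ∈ {t ∈ Finset.Icc 1 T | Y.level t ω = l} |
      x < fstar (X.best t ω) - fstar (X.act t ω)} : Finset ℕ).card : ℝ)
      ≤ (4 * b / x ^ 2 + 1) * d := by
  set J : Finset ℕ := {t ∈ {t ∈ Finset.Icc 1 T | Y.level t ω = l} |
      x < fstar (X.best t ω) - fstar (X.act t ω)} with hJ
  have hmem : ∀ t ∈ J, t ∈ Finset.Icc 1 T ∧ Y.level t ω = l ∧
      x < fstar (X.best t ω) - fstar (X.act t ω) := by
    intro t ht
    simpa only [hJ, Finset.mem_filter, and_assoc] using ht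
  have hm : 4 * b ≤ (⌊4 * b / x ^ 2⌋₊ + 1 : ℕ) * x ^ 2 := by
    rw [← div_le_iff₀ (by positivity)]
    push_cast
    exact (Nat.lt_floor_add_one _).le
  have key := card_le_mul_eluderDim hd hx hx0.le (fun t => X.act t ω) J hfF
    (Nat.succ_ne_zero ⌊4 * b / x ^ 2⌋₊) fun t ht => by
      obtain ⟨ht1, htl, htx⟩ := hmem t ht
      obtain ⟨f, hf, hfx⟩ := exists_mem_confSet_of_lt_regret hN hY ht1 (hbest t ht1)
        (hgood t ht1) hl htx
      refine ⟨f, hf.1, hfx, le_trans ?_ hm⟩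
      have hsub : {s ∈ J | s < t} ⊆ Y.indexSet t l ω := by
        intro s hs
        obtain ⟨hsJ, hst⟩ := Finset.mem_filter.1 hs
        obtain ⟨hs1, hsl, -⟩ := hmem s hsJ
        exact Finset.mem_filter.2 ⟨Finset.mem_Ico.2 ⟨(Finset.mem_Icc.1 hs1).1, hst⟩, hsl⟩
      calc ∑ s ∈ J with s < t, (f (X.act s ω) - fstar (X.act s ω)) ^ 2
          ≤ ∑ s ∈ Y.indexSet t l ω, (f (X.act s ω) - fstar (X.act s ω)) ^ 2 :=
            Finset.sum_le_sum_of_subset_of_nonneg hsub fun _ _ _ => sq_nonneg _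
        _ ≤ ∑ s ∈ Y.indexSet t l ω, (2 * (f (X.act s ω) - Y.est t l ω (X.act s ω)) ^ 2
              + 2 * (fstar (X.act s ω) - Y.est t l ω (X.act s ω)) ^ 2) :=
            Finset.sum_le_sum fun s _ => by
              nlinarith [sq_nonneg (f (X.act s ω) + fstar (X.act s ω)
                - 2 * Y.est t l ω (X.act s ω))]
        _ ≤ 4 * b := by
            rw [Finset.sum_add_distrib, ← Finset.mul_sum, ← Finset.mul_sum]
            have h1 := hf.2
            have h2 := (hgood t ht1 l hl).2
            have h3 := hβ t ht1 htl
            linarith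
  calc (J.card : ℝ) ≤ ((⌊4 * b / x ^ 2⌋₊ + 1) * d : ℕ) := by exact_mod_cast key
    _ ≤ _ := by
        push_cast
        gcongr
        exact Nat.floor_le (by positivity)

/-- The regret is nonpositive or at least the gap; summing over the levels the bound on the number
of rounds with large regret gives a bound on the cumulative regret. -/
lemma regret_mul_le (hN : coverNum F α = N) {ε₀ : ℝ} (hd : eluderDim F ε₀ = d)
    (hY : Y.IsML2 X 𝓖 F fstar T L σbar β)
    (hbest : ∀ t ∈ Finset.Icc 1 T, X.best t ω ∈ X.decision t ω)
    (hgood : ∀ t ∈ Finset.Icc 1 T, ∀ l < L, fstar ∈ Y.confSet X F (β t l) t l ω)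
    (hfF : fstar ∈ F) (hC : ∀ a, |fstar a| ≤ C) {Δ b : ℝ} (hΔ : 0 < Δ) (hε : ε₀ ≤ Δ / 2)
    (hgap : ∀ t ∈ Finset.Icc 1 T, fstar (X.best t ω) - fstar (X.act t ω) ≤ 0 ∨
      Δ ≤ fstar (X.best t ω) - fstar (X.act t ω))
    (hC0 : 0 ≤ C) (hΔC : Δ ≤ 2 * C) (hb : 0 ≤ b)
    (hβ : ∀ l, ∀ t ∈ Finset.Icc 1 T, Y.level t ω = l → β t l ^ 2 ≤ b)
    {n : ℕ} (hn : 2 * C < 2 ^ n * Δ) :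
    X.regret fstar T ω * Δ ≤ L * (2 * n * (16 * b + 4 * C ^ 2) * d) := by
  have hlevel : ∀ l ∈ Finset.range L, ∑ t ∈ Finset.Icc 1 T with Y.level t ω = l,
      (fstar (X.best t ω) - fstar (X.act t ω)) ≤ 2 * n * (4 * (4 * b) / Δ + 2 * C) * d := by
    intro l hl
    refine sum_le_of_card_lt_le hΔ (by positivity) (by positivity) (by positivity)
      (fun t ht => hgap t (Finset.mem_filter.1 ht).1) (fun t _ => ?_) (fun x hx => ?_) hn
    · have h1 := (abs_le.1 (hC (X.best t ω))).2
      have h2 := (abs_le.1 (hC (X.act t ω))).1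
      linarith
    · exact card_lt_regret_le hN hd hY hbest hgood hfF (Finset.mem_range.1 hl)
        (by linarith) (by linarith) hb (hβ l)
  have hsum : X.regret fstar T ω ≤ L * (2 * n * (4 * (4 * b) / Δ + 2 * C) * d) := by
    rw [Interaction.regret, ← Finset.sum_fiberwise_of_maps_to (s := Finset.Icc 1 T)
      (t := Finset.range L) (g := fun t => Y.level t ω)
      fun t ht => Finset.mem_range.2 (hY.level_lt t ht ω)]
    refine (Finset.sum_le_card_nsmul _ _ _ hlevel).trans (le_of_eq ?_)
    rw [Finset.card_range, nsmul_eq_mul]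
  calc X.regret fstar T ω * Δ
      ≤ L * (2 * n * (4 * (4 * b) / Δ + 2 * C) * d) * Δ := mul_le_mul_of_nonneg_right hsum hΔ.le
    _ = L * (2 * n * (16 * b + 2 * C * Δ) * d) := by field_simp; ring
    _ ≤ L * (2 * n * (16 * b + 4 * C ^ 2) * d) := by
        have h1 : 2 * C * Δ ≤ 4 * C ^ 2 := by nlinarith
        gcongr

end Regret

/-! ### Size of the logarithmic factors -/

section Logarithms

variable {T : ℕ} {R σbar δ : ℝ}

lemma numLevels_pos (hσ : 0 < σbar) (hR : σbar < R) : 1 ≤ numLevels R σbar :=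
  Nat.one_le_iff_ne_zero.2 (Nat.ceil_pos.2
    (Real.logb_pos one_lt_two ((one_lt_div hσ).2 hR))).ne'

lemma numLevels_le (hσ : 0 < σbar) (hR : σbar < R) :
    (numLevels R σbar : ℝ) ≤ 2 * Real.log (R / σbar) + 1 := by
  have hρ : 0 < Real.log (R / σbar) := Real.log_pos ((one_lt_div hσ).2 hR)
  have h1 : Real.logb 2 (R / σbar) ≤ 2 * Real.log (R / σbar) := by
    rw [Real.logb, div_le_iff₀ (Real.log_pos one_lt_two)]
    nlinarith [Real.log_two_gt_d9]
  have h2 := Nat.ceil_lt_add_one (Real.logb_pos one_lt_two ((one_lt_div hσ).2 hR)).le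
  exact h2.le.trans (by linarith)

lemma one_le_log (hσ : 0 < σbar) (hR : σbar < R) (hδ : 0 < δ) (hδ1 : δ < 1) (hT : 4 ≤ T) :
    Real.log T ≤ Real.log (T * R / (σbar * δ)) ∧ 1 ≤ Real.log (T * R / (σbar * δ)) := by
  have hT' : (4 : ℝ) ≤ T := by exact_mod_cast hT
  have h1 : Real.log T ≤ Real.log (T * R / (σbar * δ)) := by
    refine Real.log_le_log (by linarith) ?_
    rw [le_div_iff₀ (by positivity)]
    have : σbar * δ ≤ R := by nlinarith
    nlinarith
  refine ⟨h1, le_trans ?_ h1⟩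
  rw [Real.le_log_iff_exp_le (by linarith)]
  linarith [Real.exp_one_lt_d9]

lemma numLevels_le_log (hσ : 0 < σbar) (hR : σbar < R) (hδ : 0 < δ) (hδ1 : δ < 1) (hT : 4 ≤ T) :
    (numLevels R σbar : ℝ) ≤ 3 * Real.log (T * R / (σbar * δ)) := by
  have hT' : (4 : ℝ) ≤ T := by exact_mod_cast hT
  have h1 := numLevels_le hσ hR
  have h2 := (one_le_log hσ hR hδ hδ1 hT).2
  have hρ : 1 < R / σbar := (one_lt_div hσ).2 hR
  have h3 : Real.log (R / σbar) ≤ Real.log (T * R / (σbar * δ)) := by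
    refine Real.log_le_log (by linarith) ?_
    rw [show T * R / (σbar * δ) = R / σbar * (T / δ) by field_simp]
    exact le_mul_of_one_le_right (by linarith) ((one_le_div hδ).2 (by linarith))
  linarith

lemma log_confidence_le (hσ : 0 < σbar) (hR : σbar < R) (hδ : 0 < δ) (hδ1 : δ < 1) (hT : 4 ≤ T) :
    Real.log (2 * numLevels R σbar / δ) ≤ Real.log (T * R / (σbar * δ)) ∧
      ∀ t ∈ Finset.Icc 1 T, Real.log (4 * t * (t + 1) * numLevels R σbar / δ)
        ≤ 4 * Real.log (T * R / (σbar * δ)) := by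
  have hT' : (4 : ℝ) ≤ T := by exact_mod_cast hT
  have hL1 : (1 : ℝ) ≤ numLevels R σbar := by exact_mod_cast numLevels_pos hσ hR
  set L : ℝ := (numLevels R σbar : ℝ)
  obtain ⟨ρ, hρdef⟩ : ∃ ρ, ρ = R / σbar := ⟨_, rfl⟩
  have hρ : 1 < ρ := hρdef ▸ (one_lt_div hσ).2 hR
  have hL : L ≤ 2 * ρ := by
    have h1 := numLevels_le hσ hR
    have h2 := Real.log_le_sub_one_of_pos (show 0 < R / σbar by rw [← hρdef]; linarith)
    rw [← hρdef] at h1 h2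
    linarith
  have hx : T * R / (σbar * δ) = T * ρ / δ := by rw [hρdef]; field_simp
  rw [hx]
  have hρδ : 1 ≤ ρ / δ := (one_le_div hδ).2 (by linarith)
  constructor
  · refine Real.log_le_log (by positivity) ?_
    refine div_le_div_of_nonneg_right ?_ hδ.le
    nlinarith
  · intro t ht
    have ht1 : (1 : ℝ) ≤ t := by exact_mod_cast (Finset.mem_Icc.1 ht).1
    have htT : (t : ℝ) ≤ T := by exact_mod_cast (Finset.mem_Icc.1 ht).2
    rw [show (4 : ℝ) * Real.log (T * ρ / δ) = Real.log ((T * ρ / δ) ^ 4) by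
      rw [Real.log_pow]; norm_num]
    refine Real.log_le_log (by positivity) ?_
    calc 4 * (t : ℝ) * (t + 1) * L / δ ≤ 4 * T * (T + T) * (2 * ρ) / δ := by
          gcongr; linarith
      _ = 4 * 4 * (T : ℝ) ^ 2 * (ρ / δ) := by ring
      _ ≤ T * T * (T : ℝ) ^ 2 * (ρ / δ) ^ 4 := by
          gcongr
          exact le_self_pow₀ hρδ (by norm_num)
      _ = (T * ρ / δ) ^ 4 := by ring

/-- For a large horizon the confidence radii are of order `σ √(log N)` up to logarithms, where `σ`
is the largest noise level: the part due to the discretization is of lower order. -/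
lemma radius_sq_le {C s σ : ℝ} {N l t : ℕ} {α : ℝ≥0} (hσ : 0 < σbar) (hR : σbar < R)
    (hδ : 0 < δ) (hδ1 : δ < 1) (hT : 4 ≤ T) (hs : 0 < s) (hsσ : s ≤ σ) (hC : 0 ≤ C)
    (hTs : 1 ≤ T * s) (hTC : C ≤ T * s ^ 2) (hl : 2 ^ l * σbar ≤ σ) (hN : 2 ≤ N)
    (ht : t ∈ Finset.Icc 1 T) (hα : (α : ℝ) = ((T : ℝ) ^ 2)⁻¹) :
    radius C σbar α δ N (numLevels R σbar) t l ^ 2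
      ≤ 136 * (σ ^ 2 * Real.log (T * R / (σbar * δ)) * Real.log N) := by
  have hT' : (4 : ℝ) ≤ T := by exact_mod_cast hT
  have hT0 : (0 : ℝ) < T := by linarith
  have htT : (t : ℝ) ≤ T := by exact_mod_cast (Finset.mem_Icc.1 ht).2
  have hN' : (2 : ℝ) ≤ N := by exact_mod_cast hN
  have hL1 : (1 : ℝ) ≤ numLevels R σbar := by exact_mod_cast numLevels_pos hσ hR
  have hℓ := (one_le_log hσ hR hδ hδ1 hT).2
  obtain ⟨hΛ, hM⟩ := log_confidence_le hσ hR hδ hδ1 hT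
  have hM := hM t ht
  set ℓ := Real.log (T * R / (σbar * δ))
  set L : ℝ := (numLevels R σbar : ℝ)
  have hlogN : 1 / 2 ≤ Real.log N := by
    have := Real.log_le_log two_pos hN'
    linarith [Real.log_two_gt_d9]
  have hσ0 : 0 < σ := hs.trans_le hsσ
  have hS : 2 ^ (l + 1) * σbar ≤ 2 * σ := by rw [pow_succ]; linarith
  have hS0 : 0 < 2 ^ (l + 1) * σbar := by positivity
  set S := 2 ^ (l + 1) * σbar
  have h1 : Real.log (2 * N * L / δ) ≤ 3 * (ℓ * Real.log N) := by
    rw [show 2 * N * L / δ = N * (2 * L / δ) by ring, Real.log_mul (by positivity) (by positivity)]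
    nlinarith
  have h2 : √(S ^ 2 * Real.log (4 * t * (t + 1) * L / δ)) ≤ 4 * σ * ℓ := by
    refine Real.sqrt_le_iff.2 ⟨by positivity, ?_⟩
    calc S ^ 2 * Real.log (4 * t * (t + 1) * L / δ) ≤ S ^ 2 * (4 * ℓ) := by gcongr
      _ ≤ (2 * σ) ^ 2 * (4 * ℓ) := by gcongr
      _ ≤ (4 * σ * ℓ) ^ 2 := by nlinarith [mul_pos hσ0 hσ0]
  have h3 : 4 * t * α * (C + √(S ^ 2 * Real.log (4 * t * (t + 1) * L / δ))) ≤ 20 * (σ ^ 2 * ℓ) := by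
    have h4 : 4 * t * α ≤ 4 * (T : ℝ)⁻¹ := by
      rw [hα]
      calc 4 * (t : ℝ) * ((T : ℝ) ^ 2)⁻¹ ≤ 4 * T * ((T : ℝ) ^ 2)⁻¹ := by gcongr
        _ = 4 * (T : ℝ)⁻¹ := by field_simp
    calc _ ≤ 4 * (T : ℝ)⁻¹ * (T * s ^ 2 + 4 * σ * ℓ * (T * s)) := by
          gcongr
          exact h2.trans (le_mul_of_one_le_right (by positivity) hTs)
      _ = 4 * s ^ 2 + 16 * σ * ℓ * s := by field_simp; ring
      _ ≤ 4 * (σ ^ 2 * ℓ) + 16 * σ * ℓ * σ := by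
          gcongr
          have : s ^ 2 ≤ σ ^ 2 := pow_le_pow_left₀ hs.le hsσ 2
          nlinarith [sq_nonneg σ]
      _ = 20 * (σ ^ 2 * ℓ) := by ring
  have h5 : 8 * S ^ 2 * Real.log (2 * N * L / δ) ≤ 96 * (σ ^ 2 * ℓ * Real.log N) :=
    calc _ ≤ 8 * S ^ 2 * (3 * (ℓ * Real.log N)) := by gcongr
      _ ≤ 8 * (2 * σ) ^ 2 * (3 * (ℓ * Real.log N)) := by gcongr
      _ = _ := by ring
  have h6 : σ ^ 2 * ℓ ≤ 2 * (σ ^ 2 * ℓ * Real.log N) := by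
    have : 0 ≤ σ ^ 2 * ℓ := by positivity
    nlinarith
  rw [radius, Real.sq_sqrt']
  refine max_le ?_ (by positivity)
  change 8 * S ^ 2 * Real.log (2 * N * L / δ)
    + 4 * t * α * (C + √(S ^ 2 * Real.log (4 * t * (t + 1) * L / δ))) ≤ _
  linarith

end Logarithms

/-! ### The gap-dependent regret bound -/

section Main

/-- A class with two members has covering number at least `2` and positive eluder dimension at all
sufficiently fine scales. -/
lemma exists_forall_two_le_coverNum {A : Type*} (F : Set (A → ℝ)) :
    ∃ T₀ : ℕ, ∀ T ≥ T₀, 1 ≤ T → ∀ (α : ℝ≥0), (α : ℝ) = ((T : ℝ) ^ 2)⁻¹ → ∀ N d : ℕ,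
      coverNum F α = N → eluderDim F (1 / (T : ℝ) ^ 2) = d →
        F.Subsingleton ∨ (2 ≤ N ∧ 1 ≤ d) := by
  by_cases hF : F.Subsingleton
  · exact ⟨0, fun _ _ _ _ _ _ _ _ _ => Or.inl hF⟩
  obtain ⟨f, hf, g, hg, a, hfg⟩ : ∃ f ∈ F, ∃ g ∈ F, ∃ a, g a < f a := by
    obtain ⟨f, hf, g, hg, hne⟩ := Set.not_subsingleton_iff.1 hF
    obtain ⟨a, ha⟩ := Function.ne_iff.1 hne
    rcases lt_or_gt_of_ne ha with h | h
    · exact ⟨g, hg, f, hf, a, h⟩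
    · exact ⟨f, hf, g, hg, a, h⟩
  have hη : 0 < f a - g a := sub_pos.2 hfg
  obtain ⟨T₀, hT₀⟩ := exists_nat_gt (2 / (f a - g a))
  refine ⟨T₀, fun T hT hT1 α hα N d hN hd => Or.inr ?_⟩
  have hT1' : (1 : ℝ) ≤ T := by exact_mod_cast hT1
  have hscale : 2 * ((T : ℝ) ^ 2)⁻¹ < f a - g a := by
    have h1 : 2 / (f a - g a) < T := hT₀.trans_le (by exact_mod_cast hT)
    rw [div_lt_iff₀ hη] at h1
    rw [← div_eq_mul_inv, div_lt_iff₀ (by positivity)]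
    nlinarith
  have hpos : 0 < ((T : ℝ) ^ 2)⁻¹ := by positivity
  constructor
  · obtain ⟨G, hGN, -, hG⟩ := exists_finset_cover hN
    by_contra hlt
    obtain ⟨g₁, hg₁, h1⟩ := hG f hf
    obtain ⟨g₂, hg₂, h2⟩ := hG g hg
    have h12 : g₁ = g₂ := Finset.card_le_one.1 (by omega) _ hg₁ _ hg₂
    have h3 := (abs_le.1 (h1 a)).2
    have h4 := (abs_le.1 (h2 a)).1
    rw [hα] at h3 h4
    rw [h12] at h3
    linarith
  · have h1 := card_le_of_not_epsDependent hd le_rfl (fun _ => a) {0} fun t ht hdep => by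
      have h2 := hdep f hf g hg ?_
      · rw [one_div] at h2
        linarith
      · rw [Finset.filter_false_of_mem (fun s hs => by
          rw [Finset.mem_singleton] at hs ht; omega)]
        simp
    simpa using h1

/-- The number of dyadic scales between `2 / T²` and `2 C` is logarithmic in `T`. -/
lemma exists_pow_two_gt {T : ℕ} (hT : 4 ≤ T) {C : ℝ} (hC : C ≤ T) :
    ∃ n : ℕ, C * (T : ℝ) ^ 2 < 2 ^ n ∧ (n : ℝ) ≤ 7 * Real.log T := by
  have hT' : (4 : ℝ) ≤ T := by exact_mod_cast hT
  have hlog : 1 ≤ Real.log T := by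
    rw [Real.le_log_iff_exp_le (by linarith)]
    linarith [Real.exp_one_lt_d9]
  have h2 := Real.log_two_gt_d9
  refine ⟨⌊3 * Real.log T / Real.log 2⌋₊ + 1, ?_, ?_⟩
  · have h1 : (T : ℝ) ^ 3 < 2 ^ (⌊3 * Real.log T / Real.log 2⌋₊ + 1) := by
      rw [← Real.log_lt_log_iff (by positivity) (by positivity), Real.log_pow, Real.log_pow,
        ← div_lt_iff₀ (by linarith)]
      push_cast
      exact Nat.lt_floor_add_one _
    refine lt_of_le_of_lt ?_ h1
    calc C * (T : ℝ) ^ 2 ≤ T * (T : ℝ) ^ 2 := by gcongr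
      _ = (T : ℝ) ^ 3 := by ring
  · push_cast
    have h1 := Nat.floor_le (show 0 ≤ 3 * Real.log T / Real.log 2 by positivity)
    have h3 : 3 * Real.log T / Real.log 2 ≤ 6 * Real.log T := by
      rw [div_le_iff₀ (by linarith)]
      nlinarith
    linarith

variable {A Ω : Type*} {mΩ : MeasurableSpace Ω} {P : Measure Ω} {𝓖 : Filtration ℕ mΩ}
  {X : Interaction A Ω} {Y : Learner A Ω} {F : Set (A → ℝ)} {fstar : A → ℝ} {T : ℕ}
  {R : ℝ} {ω : Ω}

lemma Interaction.gap_le (hact : ∀ t ∈ Finset.Icc 1 T, X.act t ω ∈ X.decision t ω) {t : ℕ}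
    (ht : t ∈ Finset.Icc 1 T) (hlt : 0 < fstar (X.best t ω) - fstar (X.act t ω)) :
    X.gap fstar T ω ≤ ENNReal.ofReal (fstar (X.best t ω) - fstar (X.act t ω)) :=
  iInf₂_le_of_le t ht (iInf₂_le (X.act t ω) ⟨hact t ht, sub_pos.1 hlt⟩)

lemma Interaction.sd_le_sdMax {t : ℕ} (ht : t ∈ Finset.Icc 1 T) : X.sd t ω ≤ X.sdMax T ω :=
  le_csSup ((Set.finite_Icc 1 T).image _).bddAbove
    (Set.mem_image_of_mem _ (Finset.mem_Icc.1 ht))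

lemma Interaction.sdMax_lt (hT : 1 ≤ T) (hsd : ∀ t ∈ Finset.Icc 1 T, X.sd t ω < R) :
    X.sdMax T ω < R := by
  have h := Set.Nonempty.csSup_mem ((Set.nonempty_Icc.2 hT).image fun t => X.sd t ω)
    ((Set.finite_Icc 1 T).image _)
  obtain ⟨t, ht, heq⟩ := h
  rw [Interaction.sdMax, ← heq]
  exact hsd t (Finset.mem_Icc.2 ht)

/-- The bound on the event that the true function lies in all the confidence sets, for a class with
at least two members. A gap below `2 T⁻²` makes the right-hand side so large that the trivial bound
on the regret suffices. -/
lemma regret_mul_gap_le {N d : ℕ} {C s σbar δ Δ : ℝ} {α : ℝ≥0}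
    (hα : (α : ℝ) = ((T : ℝ) ^ 2)⁻¹) (hN : coverNum F α = N)
    (hd : eluderDim F (1 / (T : ℝ) ^ 2) = d)
    (hY : Y.IsML2 X 𝓖 F fstar T (numLevels R σbar) σbar
      (radius C σbar α δ N (numLevels R σbar)))
    (hbest : ∀ t ∈ Finset.Icc 1 T, X.best t ω ∈ X.decision t ω)
    (hgood : ∀ t ∈ Finset.Icc 1 T, ∀ l < numLevels R σbar,
      fstar ∈ Y.confSet X F (radius C σbar α δ N (numLevels R σbar) t l) t l ω)
    (hfF : fstar ∈ F) (hC : ∀ a, |fstar a| ≤ C) (hC0 : 0 ≤ C) (hσ : 0 < σbar) (hR : σbar < R)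
    (hδ : 0 < δ) (hδ1 : δ < 1) (hT : 4 ≤ T) (hs : 0 < s) (hsσ : s ≤ X.sdMax T ω)
    (hσσ : σbar < X.sdMax T ω) (hTs : 1 ≤ T * s) (hTC : C ≤ T * s ^ 2) (hCT : C ≤ T)
    (hTlog : C ^ 2 ≤ s ^ 2 * Real.log T) (hN2 : 2 ≤ N) (hd1 : 1 ≤ d) (hΔ : 0 ≤ Δ)
    (hΔC : Δ ≤ 2 * C)
    (hgap : ∀ t ∈ Finset.Icc 1 T, fstar (X.best t ω) - fstar (X.act t ω) ≤ 0 ∨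
      Δ ≤ fstar (X.best t ω) - fstar (X.act t ω)) :
    X.regret fstar T ω * Δ ≤ 100000 * Real.log (T * R / (σbar * δ)) ^ 3
      * (X.sdMax T ω ^ 2 * d * Real.log N) := by
  have hT' : (4 : ℝ) ≤ T := by exact_mod_cast hT
  have hT0 : (0 : ℝ) < T := by linarith
  obtain ⟨hTℓ, hℓ⟩ := one_le_log hσ hR hδ hδ1 hT
  have hLℓ := numLevels_le_log hσ hR hδ hδ1 hT
  set σ := X.sdMax T ω
  have hσ0 : 0 < σ := hs.trans_le hsσ
  have hss : s ^ 2 ≤ σ ^ 2 := pow_le_pow_left₀ hs.le hsσ 2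
  have hlogN : 1 / 2 ≤ Real.log N := by
    have := Real.log_le_log two_pos (show (2 : ℝ) ≤ N by exact_mod_cast hN2)
    linarith [Real.log_two_gt_d9]
  have hd1' : (1 : ℝ) ≤ d := by exact_mod_cast hd1
  have hrad : ∀ l, ∀ t ∈ Finset.Icc 1 T, Y.level t ω = l →
      radius C σbar α δ N (numLevels R σbar) t l ^ 2
        ≤ 136 * (σ ^ 2 * Real.log (T * R / (σbar * δ)) * Real.log N) := by
    intro l t ht hl
    refine radius_sq_le hσ hR hδ hδ1 hT hs hsσ hC0 hTs hTC ?_ hN2 ht hα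
    rw [← hl]
    exact (hY.level_le t ht ω).trans (max_le hσσ.le (X.sd_le_sdMax ht))
  set ℓ := Real.log (T * R / (σbar * δ))
  set u := σ ^ 2 * ℓ * Real.log N with hu
  have hu0 : 0 ≤ u := by positivity
  have hσu : σ ^ 2 * ℓ ≤ 2 * u := by
    have : 0 ≤ σ ^ 2 * ℓ := by positivity
    nlinarith
  have hfinal : 100000 * ℓ ^ 3 * (σ ^ 2 * d * Real.log N) = 100000 * (ℓ ^ 2 * u * d) := by
    rw [hu]; ring
  have hℓ2 : 1 ≤ ℓ ^ 2 := one_le_pow₀ hℓ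
  rw [hfinal]
  rcases lt_or_ge Δ (2 / (T : ℝ) ^ 2) with hsmall | hbig
  · have hreg : X.regret fstar T ω ≤ T * (2 * C) := by
      have h1 : X.regret fstar T ω ≤ (Finset.Icc 1 T).card • (2 * C) :=
        Finset.sum_le_card_nsmul _ _ _ fun t _ => by
          have h1 := (abs_le.1 (hC (X.best t ω))).2
          have h2 := (abs_le.1 (hC (X.act t ω))).1
          linarith
      rwa [Nat.card_Icc, Nat.add_sub_cancel, nsmul_eq_mul] at h1
    calc X.regret fstar T ω * Δ ≤ T * (2 * C) * Δ := mul_le_mul_of_nonneg_right hreg hΔ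
      _ ≤ T * (2 * (T * s ^ 2)) * (2 / (T : ℝ) ^ 2) := by gcongr
      _ = 4 * s ^ 2 := by field_simp; ring
      _ ≤ 4 * (σ ^ 2 * ℓ) := by nlinarith
      _ ≤ 100000 * (1 * u * 1) := by linarith
      _ ≤ 100000 * (ℓ ^ 2 * u * d) := by gcongr
  · have hΔ0 : 0 < Δ := lt_of_lt_of_le (by positivity) hbig
    obtain ⟨n, hn, hnlog⟩ := exists_pow_two_gt hT hCT
    have hn' : 2 * C < 2 ^ n * Δ := by
      rw [div_le_iff₀ (by positivity)] at hbig
      have h1 : C * 2 ≤ C * (Δ * (T : ℝ) ^ 2) := by gcongr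
      have h2 := mul_lt_mul_of_pos_right hn hΔ0
      linarith
    have hε : 1 / (T : ℝ) ^ 2 ≤ Δ / 2 := by
      have : 2 / (T : ℝ) ^ 2 = 2 * (1 / (T : ℝ) ^ 2) := by ring
      linarith
    have hmain := regret_mul_le hN hd hY hbest hgood hfF hC hΔ0 hε hgap hC0 hΔC
      (b := 136 * u) (by positivity) hrad hn'
    have hCu : C ^ 2 ≤ 2 * u :=
      calc C ^ 2 ≤ s ^ 2 * Real.log T := hTlog
        _ ≤ σ ^ 2 * ℓ := by gcongr
        _ ≤ 2 * u := hσu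
    calc X.regret fstar T ω * Δ
        ≤ numLevels R σbar * (2 * n * (16 * (136 * u) + 4 * C ^ 2) * d) := hmain
      _ ≤ (3 * ℓ) * (2 * (7 * ℓ) * (16 * (136 * u) + 4 * (2 * u)) * d) := by
          gcongr
          exact hnlog.trans (by linarith)
      _ = 91728 * (ℓ ^ 2 * u * d) := by ring
      _ ≤ 100000 * (ℓ ^ 2 * u * d) := by gcongr; norm_num

end Main

end HetBandit

theorem corollary2 :
    -- absolute constants: the factor and the degree of the polylogarithm hidden in `Õ`
    ∃ (K : ℝ) (p : ℕ),
    ∀ (A : Type*) [MeasurableSpace A] (F : Set (A → ℝ)), (∀ f ∈ F, Measurable f) →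
    -- how large `T` has to be depends on `F`, `C` and a lower bound `s` of `σ_max` only
    ∀ (C s : ℝ), 0 < s →
    ∃ T₀ : ℕ, ∀ T ≥ T₀, ∀ (α : ℝ≥0), α = ((T : ℝ≥0) ^ 2)⁻¹ →
    ∀ (N d : ℕ), HetBandit.coverNum F α = N → HetBandit.eluderDim F (1 / (T : ℝ) ^ 2) = d →
    ∀ (R σbar δ : ℝ), 0 < σbar → 0 < δ → δ < 1 →
    ∀ fstar ∈ F, (∀ a, |fstar a| ≤ C) →
    ∀ (Ω : Type*) (mΩ : MeasurableSpace Ω) (P : Measure Ω) [IsProbabilityMeasure P]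
      (𝓖 : Filtration ℕ mΩ) (X : HetBandit.Interaction A Ω) (Y : HetBandit.Learner A Ω),
    X.IsBandit fstar P 𝓖 T R →
    Y.IsML2 X 𝓖 F fstar T (HetBandit.numLevels R σbar) σbar
      (HetBandit.radius C σbar α δ N (HetBandit.numLevels R σbar)) →
    (∀ ω, σbar < X.sdMax T ω) → (∀ ω, s ≤ X.sdMax T ω) →
    -- the bound fails with probability at most `δ`
    P {ω | ¬ ENNReal.ofReal (X.regret fstar T ω) ≤
        ENNReal.ofReal (K * Real.log (T * R / (σbar * δ)) ^ p
          * (X.sdMax T ω ^ 2 * d * Real.log N)) / X.gap fstar T ω}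
      ≤ ENNReal.ofReal δ := by
  refine ⟨100000, 3, fun A _ F hF C s hs => ?_⟩
  obtain ⟨T₁, hT₁⟩ := HetBandit.exists_forall_two_le_coverNum F
  obtain ⟨T₂, hT₂⟩ := exists_nat_ge
    (max (max (1 / s) (C / s ^ 2)) (max C (Real.exp (C ^ 2 / s ^ 2))))
  refine ⟨max (max T₁ T₂) 4, fun T hT α hα N d hN hd R σbar δ hσ hδ hδ1 fstar hfF hC Ω mΩ P _ 𝓖
    X Y hX hY hσσ hsσ => ?_⟩
  have hT4 : 4 ≤ T := (le_max_right _ _).trans hT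
  have hTT₁ : T₁ ≤ T := (le_max_left _ _).trans ((le_max_left _ _).trans hT)
  have hTT₂ : (T₂ : ℝ) ≤ T := by
    exact_mod_cast (le_max_right T₁ T₂).trans ((le_max_left _ _).trans hT)
  have hTlarge := hT₂.trans hTT₂
  simp only [max_le_iff] at hTlarge
  obtain ⟨⟨hTs, hTC⟩, hCT, hexp⟩ := hTlarge
  rw [div_le_iff₀ hs] at hTs
  rw [div_le_iff₀ (by positivity)] at hTC
  have hTlog : C ^ 2 ≤ s ^ 2 * Real.log T := by
    have h1 := (Real.le_log_iff_exp_le ((Real.exp_pos _).trans_le hexp)).2 hexp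
    rw [div_le_iff₀ (by positivity)] at h1
    linarith
  have hα' : (α : ℝ) = ((T : ℝ) ^ 2)⁻¹ := by rw [hα]; push_cast; rfl
  obtain ⟨ω₀⟩ : Nonempty Ω := P.nonempty_of_neZero
  have hR : σbar < R := (hσσ ω₀).trans (X.sdMax_lt (by omega) fun t ht => hX.sd_lt t ht ω₀)
  have hC0 : 0 ≤ C := (abs_nonneg _).trans (hC (X.act 1 ω₀))
  have hL : 1 ≤ HetBandit.numLevels R σbar := HetBandit.numLevels_pos hσ hR
  refine (measure_mono fun ω hω => ?_).trans
    (HetBandit.measure_exists_notMem_confSet_le hF hX hY hσ hδ hδ1 hL hN hC0 hfF)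
  by_contra hgood
  simp only [Set.mem_ofPred_eq, not_exists, not_and, not_not] at hgood
  refine hω ?_
  have hbest := fun t ht => hX.best_mem t ht ω
  rcases le_or_gt (X.regret fstar T ω) 0 with hreg | hreg
  · simp [ENNReal.ofReal_eq_zero.2 hreg]
  -- a round of positive regret exists, so the gap is finite and at most `2 C`
  obtain ⟨t, ht, htpos⟩ : ∃ t ∈ Finset.Icc 1 T,
      0 < fstar (X.best t ω) - fstar (X.act t ω) := by
    by_contra! hcon
    exact absurd (Finset.sum_nonpos hcon) (not_le.2 hreg)
  have hgap := fun t ht => X.gap_le (fstar := fstar) (fun t ht => hX.act_mem t ht ω) (t := t) ht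
  have hgap_top : X.gap fstar T ω ≠ ⊤ := ((hgap t ht htpos).trans_lt ENNReal.ofReal_lt_top).ne
  have hgap_le : ∀ t ∈ Finset.Icc 1 T, fstar (X.best t ω) - fstar (X.act t ω) ≤ 0 ∨
      (X.gap fstar T ω).toReal ≤ fstar (X.best t ω) - fstar (X.act t ω) := by
    intro t ht
    refine (le_or_gt _ _).imp_right fun hpos => ?_
    exact ENNReal.toReal_le_of_le_ofReal hpos.le (hgap t ht hpos)
  have hgapC : (X.gap fstar T ω).toReal ≤ 2 * C := by
    have h1 := (abs_le.1 (hC (X.best t ω))).2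
    have h2 := (abs_le.1 (hC (X.act t ω))).1
    rcases hgap_le t ht with h | h <;> linarith
  rcases hT₁ T hTT₁ (by omega) α hα' N d hN hd with hsub | ⟨hN2, hd1⟩
  · -- with a single candidate function optimistic actions have no regret
    exfalso
    obtain ⟨f, hf, hfx⟩ := HetBandit.exists_mem_confSet_of_lt_regret hN hY ht (hbest t ht)
      (hgood t ht) (show 0 < _ by omega) htpos
    rw [hsub hf.1 hfF, sub_self] at hfx
    exact lt_irrefl _ hfx
  have hmain := HetBandit.regret_mul_gap_le hα' hN hd hY hbest hgood hfF hC hC0 hσ hR hδ hδ1 hT4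
    hs (hsσ ω) (hσσ ω) hTs hTC hCT hTlog hN2 hd1 ENNReal.toReal_nonneg hgapC hgap_le
  have hpos : 0 < 100000 * Real.log (T * R / (σbar * δ)) ^ 3
      * (X.sdMax T ω ^ 2 * d * Real.log N) := by
    have h1 : 0 < Real.log (T * R / (σbar * δ)) :=
      zero_lt_one.trans_le (HetBandit.one_le_log hσ hR hδ hδ1 hT4).2
    have h2 : 0 < X.sdMax T ω := hs.trans_le (hsσ ω)
    have h3 : (0 : ℝ) < d := by exact_mod_cast hd1
    have h4 : 0 < Real.log N := Real.log_pos (by exact_mod_cast hN2)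
    positivity
  rw [ENNReal.le_div_iff_mul_le (Or.inr (ENNReal.ofReal_pos.2 hpos).ne')
    (Or.inl hgap_top), ← ENNReal.ofReal_toReal hgap_top, ← ENNReal.ofReal_mul hreg.le]
  exact ENNReal.ofReal_le_ofReal hmain
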